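/- Let $G$ be a finite pseudograph (loops and multiple edges are allowed, $G$ may be disconnected) with $n\ge 1$ nodes, and let $r$ be its number of redundant edges, i.e. the minimal number of edges whose removal leaves a simple graph. A *tube* of $G$ is a proper connected subgraph $t$ of $G$ (with at least one node) that includes at least one edge between every pair of distinct nodes of $t$ that are joined by an edge of $G$. Two tubes are *compatible* if one properly contains the other, or if they are disjoint and no edge of $G$ joins a node of one to a node of the other. A *tubing* of $G$ is a set of pairwise compatible tubes that does not contain all connected components of $G$. A tube $t$ *excludes* an edge or loop $e$ of $G$ if $t$ contains the end node(s) of $e$ but not $e$. Write $V$ and $E$ for the sets of nodes and edges (including loops) of $G$, $V(t)$ for the nodes of $t$, $|H|$ for the number of nodes and edges of a graph $H$, and $c=4|G|^2$. The *pseudograph associahedron* $\mathcal{K}G$, realized by truncation, is the set of $(x,y)\in\mathbb{R}^V\times\mathbb{R}^E$ such that - $\sum_{v\in V}x_v=c^{\,n}$; - $\sum_{e\in B}y_e=c$ for every bundle $B$, that is, the set of all edges joining two given adjacent distinct nodes; - $\displaystyle\sum_{v\in V(t)}x_v+\sum_{e\text{ excluded by }t}y_e\ \ge\ c^{\,|V(t)|}+(|G|-|t|)^2$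 for every tube $t$ of $G$. Then $\mathcal{K}G$ has dimension $n-1+r$, and it is 1. a simple convex polytope (a bounded intersection of finitely many closed half-spaces) if $G$ has no loops, and 2. a simple polytopal cone (an unbounded intersection of finitely many closed half-spaces that contains no line) otherwise. Here a polyhedron of dimension $d$ is simple if each of its vertices lies on exactly $d$ facets. The poset of nonempty faces of $\mathcal{K}G$, ordered by inclusion, is isomorphic to the set of tubings of $G$ ordered by reverse inclusion, under an isomorphism that makes the faces of codimension $k$ correspond to the tubings with exactly $k$ tubes, for every $k$. -/

import Mathlib

open scoped Graph

noncomputable section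

/-! ### Convex polyhedra -/

namespace Polyhedral

variable {W : Type*} [AddCommGroup W] [Module ℝ W]

/-- The dimension of a set: the dimension of its affine hull. -/
def dim (P : Set W) : ℕ := Module.finrank ℝ (vectorSpan ℝ P)

/-- A convex polyhedron: an intersection of finitely many closed half-spaces. -/
def IsPolyhedron (P : Set W) : Prop :=
  ∃ s : Set (Module.Dual ℝ W × ℝ), s.Finite ∧ P = {x | ∀ h ∈ s, h.1 x ≤ h.2}

/-- A convex polytope: a bounded convex polyhedron. -/
def IsConvexPolytope [Bornology W] (P : Set W) : Prop :=
  IsPolyhedron P ∧ Bornology.IsBounded P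

/-- A polytopal cone: an unbounded convex polyhedron that contains no line. -/
def IsPolytopalCone [Bornology W] (P : Set W) : Prop :=
  IsPolyhedron P ∧ ¬ Bornology.IsBounded P ∧
    ∀ x v : W, (∀ t : ℝ, x + t • v ∈ P) → v = 0

variable [TopologicalSpace W]

/-- The nonempty faces of `P`: the nonempty sets of maximizers over `P` of a linear functional
(the zero functional gives `P` itself). -/
def IsFace (P F : Set W) : Prop := F.Nonempty ∧ IsExposed ℝ P F

/-- The poset of nonempty faces of `P`, ordered by inclusion. -/
abbrev FacePoset (P : Set W) : Type _ := {F : Set W // IsFace P F}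

/-- A polyhedron of dimension `d` is simple if every vertex lies on exactly `d` facets. -/
def IsSimple (P : Set W) : Prop :=
  ∀ v : W, IsFace P {v} →
    {F : Set W | IsFace P F ∧ dim F + 1 = dim P ∧ v ∈ F}.encard = (dim P : ℕ∞)

end Polyhedral

/-! ### Tubes and tubings of a pseudograph -/

namespace Pseudograph

variable {α β : Type*}

/-- A graph is connected if it has a node and any two nodes are joined by a walk. -/
def IsConnected (H : Graph α β) : Prop :=
  V(H).Nonempty ∧ ∀ u ∈ V(H), ∀ v ∈ V(H), Relation.ReflTransGen H.Adj u v

/-- The connected components: the maximal connected subgraphs. -/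
def IsComponent (G C : Graph α β) : Prop :=
  Maximal (fun H : Graph α β => H ≤ G ∧ IsConnected H) C

/-- A tube: a proper connected subgraph `t` of `G` that includes at least one edge between every
pair of (distinct) nodes of `t` between which `G` has an edge. -/
structure IsTube (G t : Graph α β) : Prop where
  lt : t < G
  connected : IsConnected t
  adj : ∀ u ∈ V(t), ∀ v ∈ V(t), u ≠ v → G.Adj u v → t.Adj u v

/-- Two tubes are compatible if one properly contains the other, or if they are disjoint and
cannot be connected by a single edge of `G`. -/
def TubeCompatible (G s t : Graph α β) : Prop :=
  s < t ∨ t < s ∨ (Disjoint V(s) V(t) ∧ ∀ u ∈ V(s), ∀ v ∈ V(t), ¬ G.Adj u v)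

/-- A tubing: a set of pairwise compatible tubes that does not contain all the connected
components of `G`. -/
structure IsTubing (G : Graph α β) (T : Set (Graph α β)) : Prop where
  isTube : ∀ t ∈ T, IsTube G t
  pairwise : T.Pairwise (TubeCompatible G)
  not_all_components : ¬ ∀ C, IsComponent G C → C ∈ T

/-- The tubings of `G`, ordered by inclusion. -/
abbrev Tubing (G : Graph α β) : Type _ := {T : Set (Graph α β) // IsTubing G T}

/-- The number of redundant edges: the minimal number of edges whose removal leaves a simple
graph. -/
def redundantEdges (G : Graph α β) : ℕ :=
  sInf {k | ∃ F ⊆ E(G), F.ncard = k ∧ (G.deleteEdges F).Simple}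

/-! ### The pseudograph associahedron -/

/-- The number of nodes and edges. -/
def size (H : Graph α β) : ℕ := V(H).ncard + E(H).ncard

/-- An edge (or loop) `e` of `G` is excluded by the tube `t` if `t` contains the node(s) incident
to `e` but does not contain `e` itself. -/
def Excludes (G t : Graph α β) (e : β) : Prop :=
  e ∈ E(G) ∧ e ∉ E(t) ∧ ∀ v, G.Inc e v → v ∈ V(t)

/-- Coordinates: one for every node and one for every edge or loop of `G`. -/
abbrev Space (G : Graph α β) : Type _ := (V(G) → ℝ) × (E(G) → ℝ)

/-- The constant `c = 4 |G|²` that sets the scale. -/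
def scale (G : Graph α β) : ℝ := 4 * (size G : ℝ) ^ 2

/-- The sum of the coordinates of the nodes of `t` and of the edges and loops excluded by `t`.
On the product of a simplex on the nodes, a simplex on every bundle and a ray for every loop,
for `t` not containing all nodes of `G`, the set where this (nonnegative) functional vanishes is
the face labelled by `t`: nodes of `t` name the facets through the face, edges of `t` name
vertices spanning it. If `t` contains all nodes, their contribution is constant and the
minimizers form the face labelled by `t`. -/
def tubeFunctional (G t : Graph α β) (p : Space G) : ℝ :=
  (∑ᶠ (v : V(G)) (_ : (v : α) ∈ V(t)), p.1 v) +
    ∑ᶠ (e : E(G)) (_ : Excludes G t e), p.2 e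

/-- The depth at which the tube `t` truncates. -/
def depth (G t : Graph α β) : ℝ :=
  scale G ^ V(t).ncard + ((size G : ℝ) - size t) ^ 2

/-- The pseudograph associahedron, realized by truncation: in the product of the affine spans of
a simplex on the nodes and of a simplex on every bundle of parallel non-loop edges, with a line
for every loop, there is one half-space for every tube, bounded by a hyperplane parallel to the
face labelled by the tube. -/
def associahedron (G : Graph α β) : Set (Space G) :=
  {p | (∑ᶠ v : V(G), p.1 v = scale G ^ V(G).ncard) ∧
    (∀ u v, u ≠ v → G.Adj u v →
      ∑ᶠ (e : E(G)) (_ : G.IsLink (e : β) u v), p.2 e = scale G) ∧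
    ∀ t, IsTube G t → depth G t ≤ tubeFunctional G t p}

end Pseudograph

end

/-! Write $f_t$ for `tubeFunctional G t`, $d_t$ for `depth G t` and $N=|G|$, so $c=4N^2$; the slack
of $t$ is $f_t-d_t$. The heart of the proof is uncrossing. Two incompatible tubes $s,t$ have a join
and a meet, and $f_s+f_t=f_{join}+f_{meet}$ up to two controlled sums of edge coordinates
(`tubeFunctional_join_add_meet`). The depths are too convex for this: if neither node set contains
the other, the power of $c$ in the depth of the join exceeds everything else; if one does, the
powers cancel and the squares $(N-|t|)^2$ decide. So if $s$ and $t$ both have slack at most $0$, the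
join or a component of the meet has negative slack (`uncross`). A separate estimate shows that the
components of $G$ cannot all be tubes of slack at most $0$ (`not_forall_isComponent_slack_nonpos`).

There are two consequences. At a point of the associahedron no slack is negative, so the tight tubes
form a tubing (`isTubing_tightTubes`). Conversely, let $p$ satisfy the equations and attain the
inequalities of a maximal tubing $M$. A tube of nonpositive slack that is incompatible with some
member of $M$ can be uncrossed with it into one of negative slack that is compatible with more
members; in the end it is compatible with all of them, hence in $M$, where slacks vanish. So all
tubes outside $M$ have positive slack (`mem_of_slack_nonpos`).

The functionals of a tubing, of $G$ and of the bundles are linearly independent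
(`IsTubing.coeff_eq_zero`). Hence such a $p$ exists, it can be moved so that exactly a given
$T\subseteq M$ stays tight (`IsTubing.exists_tightTubes_eq`), and each further tube lowers the
dimension of a face by one. Every face is the face of a tubing (`exists_eq_tubingFace`); the order
isomorphism, the dimension and simplicity follow. Boundedness and the absence of lines come from the
inequalities of a few explicit tubes. -/

noncomputable section

/-! ### Combinatorics of tubes: components, join, meet, compatibility. -/

namespace Pseudograph

open Set

variable {α β : Type*} {G R s t r H K C : Graph α β}

/-! ### Connected graphs and unions of components -/

/-- A connected graph has an edge leaving any set of nodes that contains some but not all of its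
nodes. -/
theorem IsConnected.exists_adj_of_mem_of_notMem (hC : IsConnected C) {A : Set α} {a b : α}
    (ha : a ∈ V(C)) (haA : a ∈ A) (hb : b ∈ V(C)) (hbA : b ∉ A) :
    ∃ x ∈ A, ∃ y, y ∉ A ∧ C.Adj x y := by
  have h := hC.2 a ha b hb
  clear hb
  induction h with
  | refl => exact absurd haA hbA
  | @tail x y _ hxy ih =>
    by_cases hx : x ∈ A
    · exact ⟨x, hx, y, hbA, hxy⟩
    · exact ih hx

theorem mem_of_reflTransGen {A : Set α} (hA : ∀ x y, H.Adj x y → x ∈ A → y ∈ A) {a b : α}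
    (ha : a ∈ A) (h : Relation.ReflTransGen H.Adj a b) : b ∈ A := by
  induction h with
  | refl => exact ha
  | tail _ hxy ih => exact hA _ _ hxy ih

theorem induce_isClosedSubgraph {A : Set α} (hA : A ⊆ V(H))
    (hcl : ∀ x y, H.Adj x y → x ∈ A → y ∈ A) : (H.induce A).IsClosedSubgraph H :=
  Graph.IsClosedSubgraph.mk' (Graph.induce_le hA) fun _ x ⟨y, h⟩ hx ↦
    ⟨x, y, h, hx, hcl x y h.adj hx⟩

/-- A nonempty disconnected graph splits into two nonempty unions of components. -/
theorem exists_split_of_not_isConnected (hne : V(H).Nonempty) (hH : ¬ IsConnected H) :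
    ∃ K₁ K₂ : Graph α β, K₁.IsClosedSubgraph H ∧ K₂.IsClosedSubgraph H ∧ V(K₁).Nonempty ∧
      V(K₂).Nonempty ∧ V(K₁) ∪ V(K₂) = V(H) ∧ Disjoint V(K₁) V(K₂) := by
  simp only [IsConnected, hne, true_and, not_forall] at hH
  obtain ⟨u, hu, v, hv, huv⟩ := hH
  set A : Set α := {x | x ∈ V(H) ∧ Relation.ReflTransGen H.Adj u x} with hA
  have hcl : ∀ x y, H.Adj x y → x ∈ A → y ∈ A := fun x y hxy hx ↦
    ⟨hxy.right_mem, hx.2.tail hxy⟩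
  refine ⟨H.induce A, H.induce (V(H) \ A), induce_isClosedSubgraph (fun x hx ↦ hx.1) hcl,
    induce_isClosedSubgraph sdiff_subset (fun x y hxy hx ↦ ⟨hxy.right_mem, fun hy ↦ hx.2 ?_⟩),
    ⟨u, hu, .refl⟩, ⟨v, hv, fun h ↦ huv h.2⟩, ?_, ?_⟩
  · exact hcl _ _ hxy.symm hy
  · exact union_sdiff_cancel (fun x hx ↦ hx.1)
  · exact disjoint_sdiff_right

/-- Induction on unions of components: a property of components that passes to disjoint unions
holds for the whole graph. -/
theorem closed_induction {P : Graph α β → Prop} (hfin : V(H).Finite) (hne : V(H).Nonempty)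
    (conn : ∀ C : Graph α β, C.IsClosedSubgraph H → IsConnected C → P C)
    (split : ∀ K K₁ K₂ : Graph α β, K.IsClosedSubgraph H → K₁.IsClosedSubgraph K →
      K₂.IsClosedSubgraph K → V(K₁).Nonempty → V(K₂).Nonempty → V(K₁) ∪ V(K₂) = V(K) →
      Disjoint V(K₁) V(K₂) → P K₁ → P K₂ → P K) : P H := by
  suffices h : ∀ n : ℕ, ∀ K : Graph α β, V(K).ncard = n → K.IsClosedSubgraph H →
      V(K).Nonempty → P K from h _ H rfl .rfl hne
  intro n
  induction n using Nat.strong_induction_on with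
  | _ n ih =>
    intro K hKn hK hKne
    by_cases hcon : IsConnected K
    · exact conn K hK hcon
    obtain ⟨K₁, K₂, h₁, h₂, hne₁, hne₂, hun, hdis⟩ := exists_split_of_not_isConnected hKne hcon
    have hKfin : V(K).Finite := hfin.subset hK.vertexSet_mono
    have hf₁ : V(K₁).Finite := hKfin.subset h₁.vertexSet_mono
    have hf₂ : V(K₂).Finite := hKfin.subset h₂.vertexSet_mono
    have hcard : V(K₁).ncard + V(K₂).ncard = n := by
      rw [← hKn, ← hun, ncard_union_eq hdis hf₁ hf₂]
    have hp₁ := (ncard_pos hf₁).2 hne₁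
    have hp₂ := (ncard_pos hf₂).2 hne₂
    exact split K K₁ K₂ hK h₁ h₂ hne₁ hne₂ hun hdis
      (ih _ (by omega) K₁ rfl (h₁.trans hK) hne₁) (ih _ (by omega) K₂ rfl (h₂.trans hK) hne₂)

/-- A connected closed subgraph is a component. -/
theorem isComponent_of_isClosedSubgraph (hC : C.IsClosedSubgraph G) (hcon : IsConnected C) :
    IsComponent G C := by
  refine ⟨⟨hC.le, hcon⟩, fun K ⟨hK, hKcon⟩ hCK ↦ ?_⟩
  refine hC.isInducedSubgraph.le_of_le_subset hK fun x hx ↦ ?_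
  obtain ⟨u, hu⟩ := hcon.1
  exact mem_of_reflTransGen (fun x y hxy hx ↦ (hC.mem_iff_of_adj (hxy.mono hK)).1 hx) hu
    (hKcon.2 u (hCK.vertexSet_mono hu) x hx)

/-! ### Subgraphs that meet every bundle -/

/-- `H` includes at least one edge of every bundle of `G` between two of its nodes. -/
def MeetsBundles (G H : Graph α β) : Prop :=
  ∀ u ∈ V(H), ∀ v ∈ V(H), u ≠ v → G.Adj u v → H.Adj u v

/-- A tube, or the whole graph if that is connected. -/
structure IsWeakTube (G t : Graph α β) : Prop where
  le : t ≤ G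
  connected : IsConnected t
  adj : MeetsBundles G t

theorem IsTube.isWeakTube (h : IsTube G t) : IsWeakTube G t := ⟨h.lt.le, h.connected, h.adj⟩

theorem IsWeakTube.isTube (h : IsWeakTube G t) (hne : t ≠ G) : IsTube G t :=
  ⟨lt_of_le_of_ne h.le hne, h.connected, h.adj⟩

theorem meetsBundles_self (G : Graph α β) : MeetsBundles G G := fun _ _ _ _ _ h ↦ h

theorem MeetsBundles.of_isClosedSubgraph (hH : MeetsBundles G H) (hK : K.IsClosedSubgraph H) :
    MeetsBundles G K := fun u hu v hv hne hadj ↦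
  (hK.adj_congr hu).2 (hH u (hK.vertexSet_mono hu) v (hK.vertexSet_mono hv) hne hadj)

/-- A graph that meets every bundle is connected if some subgraph on the same nodes is. -/
theorem MeetsBundles.isConnected (hH : MeetsBundles G H) (hK : IsConnected K) (hKG : K ≤ G)
    (hV : V(K) = V(H)) : IsConnected H := by
  refine ⟨hV ▸ hK.1, fun u hu v hv ↦ ?_⟩
  rw [← hV] at hu hv
  have h := hK.2 u hu v hv
  clear hv
  induction h with
  | refl => exact .refl
  | @tail a b _ hab ih =>
    by_cases h : a = b
    · exact h ▸ ih
    · exact ih.tail (hH a (hV ▸ hab.left_mem) b (hV ▸ hab.right_mem) h (hab.mono hKG))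

theorem le_iff_of_le_of_le (hs : s ≤ G) (ht : t ≤ G) : s ≤ t ↔ V(s) ⊆ V(t) ∧ E(s) ⊆ E(t) :=
  (Graph.Compatible.of_le_le hs ht).le_iff

theorem excludes_iff {e : β} {a b : α} (h : G.IsLink e a b) :
    Excludes G H e ↔ e ∉ E(H) ∧ a ∈ V(H) ∧ b ∈ V(H) := by
  constructor
  · rintro ⟨-, h1, h2⟩
    exact ⟨h1, h2 a h.inc_left, h2 b h.inc_right⟩
  · rintro ⟨h1, h2, h3⟩
    refine ⟨h.edge_mem, h1, fun v hv ↦ ?_⟩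
    obtain rfl | rfl := hv.eq_or_eq_of_isLink h <;> assumption

theorem mem_of_mem_edgeSet (hH : H ≤ G) {e : β} {a b : α} (h : G.IsLink e a b) (he : e ∈ E(H)) :
    a ∈ V(H) ∧ b ∈ V(H) := by
  rw [← hH.isLink_iff he] at h
  exact ⟨h.left_mem, h.right_mem⟩

/-! ### Subgraphs given by nodes and edges -/

/-- The subgraph with node set `A` and those edges in `S` that have their ends in `A`. -/
def subgraph (G : Graph α β) (A : Set α) (S : Set β) : Graph α β := (G.restrict S).induce A

@[simp]
theorem vertexSet_subgraph (A : Set α) (S : Set β) : V(subgraph G A S) = A := rfl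

theorem mem_edgeSet_subgraph {A : Set α} {S : Set β} {e : β} {a b : α} (h : G.IsLink e a b) :
    e ∈ E(subgraph G A S) ↔ e ∈ S ∧ a ∈ A ∧ b ∈ A := by
  constructor
  · rintro ⟨x, y, ⟨h1, h2⟩, hx, hy⟩
    obtain ⟨rfl, rfl⟩ | ⟨rfl, rfl⟩ := h.eq_and_eq_or_eq_and_eq h2
    · exact ⟨h1, hx, hy⟩
    · exact ⟨h1, hy, hx⟩
  · rintro ⟨h1, h2, h3⟩
    exact ⟨a, b, ⟨h1, h⟩, h2, h3⟩

theorem subgraph_le {A : Set α} {S : Set β} (hA : A ⊆ V(G)) : subgraph G A S ≤ G :=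
  ⟨hA, fun _ _ _ h ↦ h.1.2⟩

/-- The graph `t` with the edges in `Q` added. -/
def addEdges (G t : Graph α β) (Q : Set β) : Graph α β := subgraph G V(t) (E(t) ∪ Q)

theorem addEdges_le (ht : t ≤ G) (Q : Set β) : addEdges G t Q ≤ G := subgraph_le ht.vertexSet_mono

@[simp]
theorem vertexSet_addEdges (Q : Set β) : V(addEdges G t Q) = V(t) := rfl

theorem edgeSet_addEdges (ht : t ≤ G) {Q : Set β} (hQ : ∀ e ∈ Q, Excludes G t e) :
    E(addEdges G t Q) = E(t) ∪ Q := by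
  ext e
  constructor
  · rintro ⟨x, y, ⟨h1, -⟩, -⟩
    exact h1
  · intro he
    have heG : e ∈ E(G) := he.elim (fun h ↦ ht.edgeSet_mono h) (fun h ↦ (hQ e h).1)
    obtain ⟨a, b, hab⟩ := Graph.exists_isLink_of_mem_edgeSet heG
    refine (mem_edgeSet_subgraph hab).2 ⟨he, ?_⟩
    obtain he | he := he
    · exact mem_of_mem_edgeSet ht hab he
    · exact ((excludes_iff hab).1 (hQ e he)).2

theorem le_addEdges (ht : t ≤ G) (Q : Set β) : t ≤ addEdges G t Q :=
  ⟨subset_rfl, fun _ _ _ h ↦ ⟨⟨.inl h.edge_mem, h.mono ht⟩, h.left_mem, h.right_mem⟩⟩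

theorem IsWeakTube.of_le (ht : IsWeakTube G t) (hst : t ≤ s) (hs : s ≤ G) (hV : V(t) = V(s)) :
    IsWeakTube G s := by
  have h : MeetsBundles G s := fun u hu v hv hne hadj ↦
    (ht.adj u (hV ▸ hu) v (hV ▸ hv) hne hadj).mono hst
  exact ⟨hs, h.isConnected ht.connected ht.le hV, h⟩

/-! ### Join and meet of two tubes -/

/-- The union of `s` and `t`, together with the edges of `R` between nodes of `s ∪ t` that lie
neither inside `s` nor inside `t`. -/
def join (G R s t : Graph α β) : Graph α β :=
  subgraph G (V(s) ∪ V(t)) {e | e ∈ E(s) ∨ e ∈ E(t) ∨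
    (e ∈ E(R) ∧ ∀ a b, G.IsLink e a b → ¬ (a ∈ V(s) ∧ b ∈ V(s)) ∧ ¬ (a ∈ V(t) ∧ b ∈ V(t)))}

/-- The intersection of `s` and `t`, together with the edges of `t` in the bundles between common
nodes that have no edge in common to `s` and `t`. -/
def meet (G s t : Graph α β) : Graph α β :=
  subgraph G (V(s) ∩ V(t)) {e | e ∈ E(t) ∧ (e ∈ E(s) ∨
    ∀ a b, G.IsLink e a b → a ≠ b ∧ ∀ e', G.IsLink e' a b → ¬ (e' ∈ E(s) ∧ e' ∈ E(t)))}

theorem join_le_self (hs : s ≤ G) (ht : t ≤ G) : join G R s t ≤ G :=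
  subgraph_le (union_subset hs.vertexSet_mono ht.vertexSet_mono)

theorem meet_le_self (hs : s ≤ G) : meet G s t ≤ G :=
  subgraph_le (inter_subset_left.trans hs.vertexSet_mono)

@[simp] theorem vertexSet_join : V(join G R s t) = V(s) ∪ V(t) := rfl

@[simp] theorem vertexSet_meet : V(meet G s t) = V(s) ∩ V(t) := rfl

theorem left_le_join (hs : s ≤ G) : s ≤ join G R s t :=
  ⟨subset_union_left, fun _ _ _ h ↦
    ⟨⟨.inl h.edge_mem, h.mono hs⟩, .inl h.left_mem, .inl h.right_mem⟩⟩

theorem right_le_join (ht : t ≤ G) : t ≤ join G R s t :=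
  ⟨subset_union_right, fun _ _ _ h ↦
    ⟨⟨.inr (.inl h.edge_mem), h.mono ht⟩, .inr h.left_mem, .inr h.right_mem⟩⟩

/-- This is why the cross edges of a join come from `R` and not from `G`: if `R` is the least member
of a tubing above `s` and `t`, the join stays below every member above both. -/
theorem join_le (hR : R ≤ G) (hs : s ≤ R) (ht : t ≤ R) : join G R s t ≤ R := by
  refine ⟨union_subset hs.vertexSet_mono ht.vertexSet_mono, ?_⟩
  rintro e x y ⟨⟨h | h | h, hxy⟩, -⟩
  · exact (hR.isLink_iff (hs.edgeSet_mono h)).2 hxy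
  · exact (hR.isLink_iff (ht.edgeSet_mono h)).2 hxy
  · exact (hR.isLink_iff h.1).2 hxy

theorem meet_le_right (ht : t ≤ G) : meet G s t ≤ t :=
  ⟨inter_subset_right, fun _ _ _ h ↦ (ht.isLink_iff h.1.1.1).2 h.1.2⟩

theorem le_meet (hr : r ≤ G) (hs : r ≤ s) (ht : r ≤ t) : r ≤ meet G s t :=
  ⟨subset_inter hs.vertexSet_mono ht.vertexSet_mono, fun _ _ _ h ↦
    ⟨⟨⟨ht.edgeSet_mono h.edge_mem, .inl (hs.edgeSet_mono h.edge_mem)⟩, h.mono hr⟩,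
      ⟨(h.mono hs).left_mem, (h.mono ht).left_mem⟩, (h.mono hs).right_mem, (h.mono ht).right_mem⟩⟩

theorem meetsBundles_join (hs : MeetsBundles G s) (ht : MeetsBundles G t) (hR : MeetsBundles G R)
    (hRG : R ≤ G) (hsR : s ≤ R) (htR : t ≤ R) : MeetsBundles G (join G R s t) := by
  intro u hu v hv hne hadj
  by_cases h1 : u ∈ V(s) ∧ v ∈ V(s)
  · exact (hs u h1.1 v h1.2 hne hadj).mono (left_le_join (hsR.trans hRG))
  by_cases h2 : u ∈ V(t) ∧ v ∈ V(t)
  · exact (ht u h2.1 v h2.2 hne hadj).mono (right_le_join (htR.trans hRG))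
  have hVR : V(s) ∪ V(t) ⊆ V(R) := union_subset hsR.vertexSet_mono htR.vertexSet_mono
  obtain ⟨e, he⟩ := hR u (hVR hu) v (hVR hv) hne hadj
  refine ⟨e, ⟨.inr (.inr ⟨he.edge_mem, fun a b hab ↦ ?_⟩), he.mono hRG⟩, hu, hv⟩
  obtain ⟨rfl, rfl⟩ | ⟨rfl, rfl⟩ := hab.eq_and_eq_or_eq_and_eq (he.mono hRG)
  · exact ⟨h1, h2⟩
  · exact ⟨fun h ↦ h1 h.symm, fun h ↦ h2 h.symm⟩

/-- The second clause of `meet` serves this statement: where `s` and `t` choose disjoint edges from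
a bundle, the plain intersection would have none. Taking the edges of `t` alone keeps the meet below
`t`. -/
theorem meetsBundles_meet (htG : t ≤ G) (ht : MeetsBundles G t) :
    MeetsBundles G (meet G s t) := by
  rintro u ⟨hus, hut⟩ v ⟨hvs, hvt⟩ hne hadj
  by_cases h : ∃ e', G.IsLink e' u v ∧ e' ∈ E(s) ∧ e' ∈ E(t)
  · obtain ⟨e', h, hs', ht'⟩ := h
    exact ⟨e', ⟨⟨ht', .inl hs'⟩, h⟩, ⟨hus, hut⟩, hvs, hvt⟩
  · push Not at h
    obtain ⟨e, he⟩ := ht u hut v hvt hne hadj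
    refine ⟨e, ⟨⟨he.edge_mem, .inr fun a b hab ↦ ?_⟩, he.mono htG⟩, ⟨hus, hut⟩, hvs, hvt⟩
    obtain ⟨rfl, rfl⟩ | ⟨rfl, rfl⟩ := hab.eq_and_eq_or_eq_and_eq (he.mono htG)
    · exact ⟨hne, fun e' he' h' ↦ h e' he' h'.1 h'.2⟩
    · exact ⟨hne.symm, fun e' he' h' ↦ h e' he'.symm h'.1 h'.2⟩

/-! ### Weak compatibility -/

/-- Equal or compatible. -/
def WeaklyCompatible (G s t : Graph α β) : Prop :=
  s ≤ t ∨ t ≤ s ∨ (Disjoint V(s) V(t) ∧ ∀ u ∈ V(s), ∀ v ∈ V(t), ¬ G.Adj u v)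

theorem WeaklyCompatible.symm (h : WeaklyCompatible G s t) : WeaklyCompatible G t s := by
  obtain h | h | h := h
  · exact .inr (.inl h)
  · exact .inl h
  · exact .inr (.inr ⟨h.1.symm, fun u hu v hv hadj ↦ h.2 v hv u hu hadj.symm⟩)

theorem TubeCompatible.weaklyCompatible (h : TubeCompatible G s t) : WeaklyCompatible G s t := by
  obtain h | h | h := h
  · exact .inl h.le
  · exact .inr (.inl h.le)
  · exact .inr (.inr h)

theorem WeaklyCompatible.tubeCompatible (h : WeaklyCompatible G s t) (hne : s ≠ t) :
    TubeCompatible G s t := by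
  obtain h | h | h := h
  · exact .inl (lt_of_le_of_ne h hne)
  · exact .inr (.inl (lt_of_le_of_ne h hne.symm))
  · exact .inr (.inr h)

theorem WeaklyCompatible.le_or_le (h : WeaklyCompatible G s t) {v : α} (hs : v ∈ V(s))
    (ht : v ∈ V(t)) : s ≤ t ∨ t ≤ s := by
  obtain h | h | h := h
  · exact .inl h
  · exact .inr h
  · exact absurd ht (disjoint_left.1 h.1 hs)

theorem WeaklyCompatible.anti_separated
    (h : Disjoint V(s) V(t) ∧ ∀ u ∈ V(s), ∀ v ∈ V(t), ¬ G.Adj u v) {s' t' : Graph α β}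
    (hs : V(s') ⊆ V(s)) (ht : V(t') ⊆ V(t)) : WeaklyCompatible G s' t' :=
  .inr (.inr ⟨h.1.mono hs ht, fun u hu v hv ↦ h.2 u (hs hu) v (ht hv)⟩)

theorem isConnected_join (hs : IsConnected s) (ht : IsConnected t)
    (hm : MeetsBundles G (join G R s t)) (hsG : s ≤ G) (htG : t ≤ G)
    (hst : ¬ WeaklyCompatible G s t) : IsConnected (join G R s t) := by
  have key : ∃ a ∈ V(s), ∃ b ∈ V(t), Relation.ReflTransGen (join G R s t).Adj a b := by
    by_cases hd : Disjoint V(s) V(t)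
    · have : ¬ ∀ u ∈ V(s), ∀ v ∈ V(t), ¬ G.Adj u v := fun h ↦ hst (.inr (.inr ⟨hd, h⟩))
      push Not at this
      obtain ⟨u, hu, v, hv, huv⟩ := this
      exact ⟨u, hu, v, hv, .single (hm u (.inl hu) v (.inr hv)
        (fun h ↦ disjoint_left.1 hd hu (h ▸ hv)) huv)⟩
    · obtain ⟨v, hv, hv'⟩ := not_disjoint_iff.1 hd
      exact ⟨v, hv, v, hv', .refl⟩
  obtain ⟨a, ha, b, hb, hab⟩ := key
  have hsym : ∀ {x y}, Relation.ReflTransGen (join G R s t).Adj x y →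
      Relation.ReflTransGen (join G R s t).Adj y x := fun h ↦
    Std.Symm.symm _ _ h
  have hal : ∀ x ∈ V(join G R s t), Relation.ReflTransGen (join G R s t).Adj a x := by
    rintro x (hx | hx)
    · exact Relation.ReflTransGen.mono (fun _ _ h ↦ h.mono (left_le_join hsG)) _ _ (hs.2 a ha x hx)
    · exact hab.trans (Relation.ReflTransGen.mono (fun _ _ h ↦ h.mono (right_le_join htG)) _ _
        (ht.2 b hb x hx))
  exact ⟨⟨a, .inl ha⟩, fun u hu v hv ↦ (hsym (hal u hu)).trans (hal v hv)⟩

theorem isWeakTube_join (hs : IsWeakTube G s) (ht : IsWeakTube G t) (hR : MeetsBundles G R)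
    (hRG : R ≤ G) (hsR : s ≤ R) (htR : t ≤ R) (hst : ¬ WeaklyCompatible G s t) :
    IsWeakTube G (join G R s t) := by
  have hm := meetsBundles_join hs.adj ht.adj hR hRG hsR htR
  exact ⟨join_le_self hs.le ht.le, isConnected_join hs.connected ht.connected hm hs.le ht.le hst,
    hm⟩

/-- A graph weakly compatible with `s` and `t` is weakly compatible with their join. -/
theorem weaklyCompatible_join (hs : s ≤ G) (ht : t ≤ G) (hst : ¬ WeaklyCompatible G s t)
    (hrR : s ≤ r → t ≤ r → join G R s t ≤ r) (h1 : WeaklyCompatible G r s)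
    (h2 : WeaklyCompatible G r t) : WeaklyCompatible G r (join G R s t) := by
  obtain h1 | h1 | h1 := h1
  · exact .inl (h1.trans (left_le_join hs))
  · obtain h2 | h2 | h2 := h2
    · exact .inl (h2.trans (right_le_join ht))
    · exact .inr (.inl (hrR h1 h2))
    · exact absurd (WeaklyCompatible.anti_separated h2 h1.vertexSet_mono subset_rfl) hst
  · obtain h2 | h2 | h2 := h2
    · exact .inl (h2.trans (right_le_join ht))
    · exact absurd (WeaklyCompatible.anti_separated h1 h2.vertexSet_mono subset_rfl)
        (fun h ↦ hst h.symm)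
    · refine .inr (.inr ⟨disjoint_union_right.2 ⟨h1.1, h2.1⟩, ?_⟩)
      rintro u hu v (hv | hv)
      · exact h1.2 u hu v hv
      · exact h2.2 u hu v hv

/-- A connected graph weakly compatible with `s` and `t` is weakly compatible with every component
of their meet. -/
theorem weaklyCompatible_component_meet (hr : r ≤ G) (hrc : IsConnected r)
    (ht : t ≤ G) (htb : MeetsBundles G t) (hC : C.IsClosedSubgraph (meet G s t))
    (hst : ¬ WeaklyCompatible G s t) (h1 : WeaklyCompatible G r s) (h2 : WeaklyCompatible G r t) :
    WeaklyCompatible G r C := by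
  have hCs : V(C) ⊆ V(s) := hC.vertexSet_mono.trans inter_subset_left
  have hCt : V(C) ⊆ V(t) := hC.vertexSet_mono.trans inter_subset_right
  obtain h2 | h2 | h2 := h2
  · obtain h1 | h1 | h1 := h1
    -- Now `r` is a connected subgraph of the meet, so it lies in the component `C` or misses it. If
    -- it misses `C`, no edge of `G` joins the two, since the meet would contain an edge of that
    -- bundle.
    · have hrm : r ≤ meet G s t := le_meet hr h1 h2
      have hmem : ∀ {x y}, x ∈ V(r) → y ∈ V(r) → x ∈ V(C) → y ∈ V(C) := fun {x y} hx hy hxC ↦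
        mem_of_reflTransGen (fun a b hab ha ↦ (hC.mem_iff_of_adj (hab.mono hrm)).1 ha) hxC
          (hrc.2 x hx y hy)
      by_cases h : ∃ x ∈ V(r), x ∈ V(C)
      · obtain ⟨x, hx, hxC⟩ := h
        exact .inl (hC.isInducedSubgraph.le_of_le_subset hrm fun y hy ↦ hmem hx hy hxC)
      · push Not at h
        refine .inr (.inr ⟨disjoint_left.2 h, fun u hu v hv hadj ↦ h u hu ?_⟩)
        have hne : u ≠ v := fun huv ↦ h u hu (huv ▸ hv)
        have := meetsBundles_meet ht htb u (hrm.vertexSet_mono hu) v (hC.vertexSet_mono hv)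
          hne hadj
        exact (hC.mem_iff_of_adj this).2 hv
    · exact absurd (.inl (h1.trans h2)) hst
    · exact WeaklyCompatible.anti_separated h1 subset_rfl hCs
  · exact .inr (.inl ((hC.le.trans (meet_le_right ht)).trans h2))
  · exact WeaklyCompatible.anti_separated h2 subset_rfl hCt

theorem isWeakTube_component_meet (hs : s ≤ G) (ht : IsWeakTube G t)
    (hC : C.IsClosedSubgraph (meet G s t)) (hcon : IsConnected C) : IsWeakTube G C :=
  ⟨hC.le.trans (meet_le_self hs), hcon,
    (meetsBundles_meet ht.le ht.adj).of_isClosedSubgraph hC⟩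

end Pseudograph

/-! ### Linear identities for the tube functionals, and estimates of depths and edge sums. -/

namespace Pseudograph

open Set
open scoped Classical

set_option linter.unusedSectionVars false

variable {α β : Type*} {G R s t r H K K₁ K₂ C : Graph α β}

/-! ### Sums of coordinates -/

section Sums

variable [Fintype V(G)] [Fintype E(G)]

/-- The sum of the coordinates of the nodes in `A`. -/
def nodeSum (p : Space G) (A : Set α) : ℝ := ∑ v : V(G), if (v : α) ∈ A then p.1 v else 0

/-- The sum of the coordinates of the edges in `S`. -/
def edgeSum (p : Space G) (S : Set β) : ℝ := ∑ e : E(G), if (e : β) ∈ S then p.2 e else 0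

theorem edgeSum_eq_sum (p : Space G) {S : Set β} {F : Finset E(G)}
    (h : ∀ e, e ∈ F ↔ (e : β) ∈ S) : edgeSum p S = ∑ e ∈ F, p.2 e := by
  simp [edgeSum, ← h]

theorem tubeFunctional_eq (t : Graph α β) (p : Space G) :
    tubeFunctional G t p = nodeSum p V(t) + edgeSum p {e | Excludes G t e} := by
  simp only [tubeFunctional, nodeSum, edgeSum, finsum_eq_sum_of_fintype, finsum_eq_if,
    mem_ofPred_eq]

theorem nodeSum_union_add_inter (p : Space G) (A B : Set α) :
    nodeSum p A + nodeSum p B = nodeSum p (A ∪ B) + nodeSum p (A ∩ B) := by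
  simp only [nodeSum, ← Finset.sum_add_distrib]
  refine Finset.sum_congr rfl fun v _ ↦ ?_
  by_cases h1 : (v : α) ∈ A <;> by_cases h2 : (v : α) ∈ B <;> simp [h1, h2]

@[simp] theorem nodeSum_empty (p : Space G) : nodeSum p ∅ = 0 := by simp [nodeSum]

@[simp] theorem edgeSum_empty (p : Space G) : edgeSum p ∅ = 0 := by simp [edgeSum]

theorem edgeSum_union (p : Space G) {A B : Set β} (h : Disjoint A B) :
    edgeSum p (A ∪ B) = edgeSum p A + edgeSum p B := by
  simp only [edgeSum, ← Finset.sum_add_distrib]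
  refine Finset.sum_congr rfl fun e _ ↦ ?_
  by_cases h1 : (e : β) ∈ A
  · simp [h1, disjoint_left.1 h h1]
  · simp [h1]

/-- The edges between nodes of `s` and `t` that lie neither inside `s` nor inside `t`, and do not
belong to `R`. -/
def crossEdges (G R s t : Graph α β) : Set β :=
  {e | e ∉ E(R) ∧ ∃ a b, G.IsLink e a b ∧ a ∈ V(s) ∪ V(t) ∧ b ∈ V(s) ∪ V(t) ∧
    ¬ (a ∈ V(s) ∧ b ∈ V(s)) ∧ ¬ (a ∈ V(t) ∧ b ∈ V(t))}

theorem mem_crossEdges {e : β} {a b : α} (h : G.IsLink e a b) :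
    e ∈ crossEdges G R s t ↔ e ∉ E(R) ∧ a ∈ V(s) ∪ V(t) ∧ b ∈ V(s) ∪ V(t) ∧
    ¬ (a ∈ V(s) ∧ b ∈ V(s)) ∧ ¬ (a ∈ V(t) ∧ b ∈ V(t)) := by
  constructor
  · rintro ⟨h1, x, y, hxy, h2⟩
    obtain ⟨rfl, rfl⟩ | ⟨rfl, rfl⟩ := h.eq_and_eq_or_eq_and_eq hxy <;> tauto
  · rintro ⟨h1, h2⟩
    exact ⟨h1, a, b, h, h2⟩

theorem mem_edgeSet_join {e : β} {a b : α} (h : G.IsLink e a b) :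
    e ∈ E(join G R s t) ↔ (e ∈ E(s) ∨ e ∈ E(t) ∨ (e ∈ E(R) ∧ ¬ (a ∈ V(s) ∧ b ∈ V(s)) ∧
      ¬ (a ∈ V(t) ∧ b ∈ V(t)))) ∧ a ∈ V(s) ∪ V(t) ∧ b ∈ V(s) ∪ V(t) := by
  rw [join, mem_edgeSet_subgraph h, mem_ofPred_eq]
  have : (∀ x y, G.IsLink e x y → ¬ (x ∈ V(s) ∧ y ∈ V(s)) ∧ ¬ (x ∈ V(t) ∧ y ∈ V(t))) ↔
      ¬ (a ∈ V(s) ∧ b ∈ V(s)) ∧ ¬ (a ∈ V(t) ∧ b ∈ V(t)) := by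
    refine ⟨fun h' ↦ h' a b h, fun h' x y hxy ↦ ?_⟩
    obtain ⟨rfl, rfl⟩ | ⟨rfl, rfl⟩ := h.eq_and_eq_or_eq_and_eq hxy <;> tauto
  rw [this]

/-- Node sums are modular; excluded edges are modular with two exceptions. A cross edge outside `R`
is excluded by the join but by neither `s` nor `t`. An edge of the meet outside `s` is excluded by
`s` but by neither the join nor the meet. -/
theorem tubeFunctional_join_add_meet (hs : s ≤ G) (ht : t ≤ G) (p : Space G) :
    tubeFunctional G s p + tubeFunctional G t p + edgeSum p (crossEdges G R s t) =
      tubeFunctional G (join G R s t) p + tubeFunctional G (meet G s t) p +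
        edgeSum p (E(meet G s t) \ E(s)) := by
  simp only [tubeFunctional_eq]
  have hn := nodeSum_union_add_inter p V(s) V(t)
  suffices h : edgeSum p {e | Excludes G s e} + edgeSum p {e | Excludes G t e} +
      edgeSum p (crossEdges G R s t) = edgeSum p {e | Excludes G (join G R s t) e} +
      edgeSum p {e | Excludes G (meet G s t) e} + edgeSum p (E(meet G s t) \ E(s)) by
    simp only [vertexSet_join, vertexSet_meet]
    linarith
  simp only [edgeSum, ← Finset.sum_add_distrib]
  refine Finset.sum_congr rfl fun e _ ↦ ?_
  obtain ⟨a, b, hab⟩ := Graph.exists_isLink_of_mem_edgeSet e.2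
  have h1 := mem_of_mem_edgeSet hs hab
  have h2 := mem_of_mem_edgeSet ht hab
  simp only [mem_ofPred_eq, excludes_iff hab, mem_crossEdges hab, mem_edgeSet_join hab, mem_sdiff,
    meet, mem_edgeSet_subgraph hab, vertexSet_join, vertexSet_subgraph, mem_union, mem_inter_iff]
  -- Only the truth value of the bundle condition matters; the rest is a finite case check on
  -- memberships.
  generalize (∀ (x y : α), G.IsLink (↑e) x y → x ≠ y ∧
    ∀ (e' : β), G.IsLink e' x y → ¬(e' ∈ E(s) ∧ e' ∈ E(t))) = X
  generalize p.2 e = y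
  by_cases ha : a ∈ V(s) <;> by_cases hb : b ∈ V(s) <;> by_cases ha' : a ∈ V(t) <;>
    by_cases hb' : b ∈ V(t) <;> simp only [ha, hb, ha', hb', imp_false, and_true,
    and_false, false_and, or_true, or_false, not_true, not_false_eq_true,
    if_false, add_zero, zero_add] at h1 h2 ⊢ <;>
    by_cases hes : (e : β) ∈ E(s) <;> by_cases het : (e : β) ∈ E(t) <;>
    by_cases heR : (e : β) ∈ E(R) <;> by_cases hX : X <;> simp_all

/-- Since `K` meets every bundle, no edge of `G` joins the two parts, so each excluded edge belongs
to exactly one of them. -/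
theorem tubeFunctional_split (hK : MeetsBundles G K) (h₁ : K₁.IsClosedSubgraph K)
    (h₂ : K₂.IsClosedSubgraph K) (hun : V(K₁) ∪ V(K₂) = V(K)) (hdis : Disjoint V(K₁) V(K₂))
    (hKG : K ≤ G) (p : Space G) :
    tubeFunctional G K p = tubeFunctional G K₁ p + tubeFunctional G K₂ p := by
  simp only [tubeFunctional_eq]
  have hn := nodeSum_union_add_inter p V(K₁) V(K₂)
  rw [hun, hdis.inter_eq, nodeSum_empty] at hn
  suffices h : edgeSum p {e | Excludes G K e} = edgeSum p {e | Excludes G K₁ e} +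
      edgeSum p {e | Excludes G K₂ e} by linarith
  rw [← edgeSum_union]
  · congr 1
    ext e
    by_cases he : e ∈ E(G)
    swap
    · simp [Excludes, he]
    obtain ⟨a, b, hab⟩ := Graph.exists_isLink_of_mem_edgeSet he
    have hcl : ∀ {L : Graph α β}, L.IsClosedSubgraph K → a ∈ V(L) → b ∈ V(K) → b ∈ V(L) :=
      fun {L} hL ha hb ↦ by
        by_cases hne : a = b
        · exact hne ▸ ha
        · exact (hL.mem_iff_of_adj (hK a (hL.vertexSet_mono ha) b hb hne hab.adj)).1 ha
    have hedge : ∀ {L : Graph α β}, L.IsClosedSubgraph K → a ∈ V(L) → (e ∈ E(K) ↔ e ∈ E(L)) :=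
      fun {L} hL ha ↦ ⟨fun h ↦ hL.closed ((hKG.isLink_iff h).2 hab).inc_left ha,
        fun h ↦ hL.edgeSet_mono h⟩
    have hm₁ := h₁.vertexSet_mono
    have hm₂ := h₂.vertexSet_mono
    simp only [mem_ofPred_eq, mem_union, excludes_iff hab]
    constructor
    · rintro ⟨h, ha, hb⟩
      rw [← hun] at ha
      obtain ha | ha := ha
      · exact .inl ⟨(hedge h₁ ha).not.1 h, ha, hcl h₁ ha hb⟩
      · exact .inr ⟨(hedge h₂ ha).not.1 h, ha, hcl h₂ ha hb⟩
    · rintro (⟨h, ha, hb⟩ | ⟨h, ha, hb⟩)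
      · exact ⟨(hedge h₁ ha).not.2 h, hm₁ ha, hm₁ hb⟩
      · exact ⟨(hedge h₂ ha).not.2 h, hm₂ ha, hm₂ hb⟩
  · refine disjoint_left.2 fun e he he' ↦ ?_
    obtain ⟨a, b, hab⟩ := Graph.exists_isLink_of_mem_edgeSet he.1
    exact disjoint_left.1 hdis ((excludes_iff hab).1 he).2.1 ((excludes_iff hab).1 he').2.1

theorem tubeFunctional_addEdges (ht : t ≤ G) {Q : Set β} (hQ : ∀ e ∈ Q, Excludes G t e)
    (p : Space G) :
    tubeFunctional G t p = tubeFunctional G (addEdges G t Q) p + edgeSum p Q := by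
  simp only [tubeFunctional_eq, vertexSet_addEdges, add_assoc]
  rw [← edgeSum_union]
  · congr 2
    ext e
    by_cases he : e ∈ E(G)
    swap
    · simp only [mem_ofPred_eq, Excludes, he, false_and, mem_union, false_or, false_iff]
      exact fun h ↦ he (hQ e h).1
    obtain ⟨a, b, hab⟩ := Graph.exists_isLink_of_mem_edgeSet he
    have := hQ e
    simp only [mem_ofPred_eq, mem_union, excludes_iff hab, edgeSet_addEdges ht hQ,
      vertexSet_addEdges] at this ⊢
    tauto
  · refine disjoint_left.2 fun e he he' ↦ he.2.1 ?_
    rw [edgeSet_addEdges ht hQ]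
    exact .inr he'

theorem tubeFunctional_eq_zero_of_isEmpty (h : V(t) = ∅) (p : Space G) :
    tubeFunctional G t p = 0 := by
  have : {e | Excludes G t e} = ∅ := by
    refine eq_empty_of_forall_notMem fun e he ↦ ?_
    obtain ⟨a, b, hab⟩ := Graph.exists_isLink_of_mem_edgeSet he.1
    simpa [h] using ((excludes_iff hab).1 he).2.1
  rw [tubeFunctional_eq, this, h]
  simp

theorem tubeFunctional_self (p : Space G) : tubeFunctional G G p = nodeSum p V(G) := by
  have : {e | Excludes G G e} = ∅ := eq_empty_of_forall_notMem fun e he ↦ he.2.1 he.1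
  rw [tubeFunctional_eq, this]
  simp

/-! ### The affine span of the associahedron -/

/-- The equations of the associahedron. -/
structure InSpan (p : Space G) : Prop where
  node : nodeSum p V(G) = scale G ^ V(G).ncard
  bundle : ∀ u v, u ≠ v → G.Adj u v → edgeSum p {e | G.IsLink e u v} = scale G

theorem mem_associahedron_iff {p : Space G} : p ∈ associahedron G ↔
    InSpan p ∧ ∀ t, IsTube G t → depth G t ≤ tubeFunctional G t p := by
  have h1 : ∑ᶠ v : V(G), p.1 v = nodeSum p V(G) := by
    simp [nodeSum, finsum_eq_sum_of_fintype]
  have h2 : ∀ u v, ∑ᶠ (e : E(G)) (_ : G.IsLink (e : β) u v), p.2 e =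
      edgeSum p {e | G.IsLink e u v} := fun u v ↦ by
    simp only [edgeSum, finsum_eq_sum_of_fintype, finsum_eq_if, mem_ofPred_eq]
  simp only [associahedron, mem_ofPred_eq, h1, h2, ← and_assoc]
  exact and_congr_left fun _ ↦ ⟨fun h ↦ ⟨h.1, h.2⟩, fun h ↦ ⟨h.1, h.2⟩⟩

/-- By how much `p` satisfies the inequality of `t`. -/
def slack (p : Space G) (t : Graph α β) : ℝ := tubeFunctional G t p - depth G t

end Sums

/-! ### Sizes -/

section Sizes

variable [Fintype V(G)] [Fintype E(G)]

theorem ncard_vertexSet_le (hst : s ≤ t) (ht : t ≤ G) : V(s).ncard ≤ V(t).ncard :=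
  ncard_le_ncard hst.vertexSet_mono ((toFinite V(G)).subset ht.vertexSet_mono)

theorem size_le_size (hst : s ≤ t) (ht : t ≤ G) : size s ≤ size t :=
  Nat.add_le_add (ncard_vertexSet_le hst ht)
    (ncard_le_ncard hst.edgeSet_mono ((toFinite E(G)).subset ht.edgeSet_mono))

theorem size_lt_size (hst : s < t) (ht : t ≤ G) : size s < size t := by
  have hV := (toFinite V(G)).subset ht.vertexSet_mono
  have hE := (toFinite E(G)).subset ht.edgeSet_mono
  have h1 := ncard_le_ncard hst.le.vertexSet_mono hV
  have h2 := ncard_le_ncard hst.le.edgeSet_mono hE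
  rw [size, size]
  obtain h | h := Graph.vertexSet_ssubset_or_edgeSet_ssubset_of_lt hst
  · have := ncard_lt_ncard h hV; omega
  · have := ncard_lt_ncard h hE; omega

theorem size_pos (hne : V(G).Nonempty) : 1 ≤ size G := by
  have := (ncard_pos (toFinite V(G))).2 hne
  rw [size]; omega

theorem four_le_scale (hne : V(G).Nonempty) : 4 ≤ scale G := by
  have : (1 : ℝ) ≤ size G := by exact_mod_cast size_pos hne
  rw [scale]; nlinarith

theorem sq_sub_size_le (ht : t ≤ G) : ((size G : ℝ) - size t) ^ 2 ≤ (size G : ℝ) ^ 2 := by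
  have h1 : (size t : ℝ) ≤ size G := by exact_mod_cast size_le_size ht le_rfl
  have h2 : (0 : ℝ) ≤ size t := Nat.cast_nonneg _
  nlinarith

theorem depth_self : depth G G = scale G ^ V(G).ncard := by simp [depth]

theorem depth_le (ht : t ≤ G) :
    depth G t ≤ scale G ^ V(t).ncard + (size G : ℝ) ^ 2 := by
  rw [depth]; linarith [sq_sub_size_le ht]

theorem le_depth (t : Graph α β) : scale G ^ V(t).ncard ≤ depth G t := by
  rw [depth]; nlinarith [sq_nonneg ((size G : ℝ) - size t)]

theorem InSpan.slack_self {p : Space G} (hp : InSpan p) : slack p G = 0 := by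
  rw [slack, tubeFunctional_self, hp.node, depth_self, sub_self]

/-- Adding `Q` to `t` keeps the nodes, hence the power of $c$ in the depth, and lowers the
functional by the sum over `Q`. Only the square in the depth of `t` is left to bound that sum. -/
theorem edgeSum_le_of_slack (ht : t ≤ G) {Q : Set β} (hQ : ∀ e ∈ Q, Excludes G t e)
    {p : Space G} (h0 : slack p t ≤ 0) (h1 : 0 ≤ slack p (addEdges G t Q)) :
    edgeSum p Q ≤ (size G : ℝ) ^ 2 := by
  have h2 := tubeFunctional_addEdges ht hQ p
  have h3 := depth_le ht
  have h4 := le_depth (G := G) (addEdges G t Q)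
  rw [vertexSet_addEdges] at h4
  simp only [slack] at h0 h1
  linarith

theorem crossEdges_subset_excludes (hs : s ≤ R) (ht : t ≤ R) :
    ∀ e ∈ crossEdges G R s t, Excludes G R e := by
  rintro e ⟨he, a, b, hab, ha, hb, -⟩
  have := union_subset hs.vertexSet_mono ht.vertexSet_mono
  exact (excludes_iff hab).2 ⟨he, this ha, this hb⟩

theorem crossEdges_self : crossEdges G G s t = ∅ :=
  eq_empty_of_forall_notMem fun _ he ↦ he.1 (Exists.choose_spec (Exists.choose_spec he.2)).1.edge_mem

/-- The unordered pair of the ends of an edge. -/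
def ends (G : Graph α β) (e : E(G)) : Sym2 α :=
  s((G.exists_isLink_of_mem_edgeSet e.2).choose,
    (G.exists_isLink_of_mem_edgeSet e.2).choose_spec.choose)

theorem isLink_iff_ends (e : E(G)) {a b : α} : G.IsLink e a b ↔ ends G e = s(a, b) :=
  (G.exists_isLink_of_mem_edgeSet e.2).choose_spec.choose_spec.isLink_iff_sym2_eq

/-- The edges of `meet G s t` outside `s` form whole intersections of `t` with bundles. -/
theorem edgeSum_meet_diff (htG : t ≤ G) {p : Space G} (hp : InSpan p)
    (ht : ∀ Q : Set β, (∀ e ∈ Q, Excludes G t e) → edgeSum p Q ≤ (size G : ℝ) ^ 2) :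
    E(meet G s t) \ E(s) = ∅ ∨ 3 * (size G : ℝ) ^ 2 ≤ edgeSum p (E(meet G s t) \ E(s)) := by
  refine or_iff_not_imp_left.2 fun hne ↦ ?_
  set Z := E(meet G s t) \ E(s) with hZ
  -- In such a bundle `s` and `t` have no common edge, so the meet takes all edges of `t`. The
  -- bundle sums to $c=4N^2$ and the edges excluded by `t` to at most $N^2$, which leaves $3N^2$.
  have key : ∀ e : E(G), (e : β) ∈ Z → 3 * (size G : ℝ) ^ 2 ≤
      ∑ e' ∈ {e' : E(G) | (e' : β) ∈ Z} with ends G e' = ends G e, p.2 e' := by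
    intro e he
    obtain ⟨a, b, hab⟩ := Graph.exists_isLink_of_mem_edgeSet e.2
    obtain ⟨⟨⟨het, hX⟩, ⟨has, hat⟩, hbs, hbt⟩, hes⟩ :=
      (⟨(mem_edgeSet_subgraph hab).1 he.1, he.2⟩ : _ ∧ _)
    have hX := hX.resolve_left hes
    obtain ⟨hne, hX'⟩ := hX a b hab
    have h1 := hp.bundle a b hne hab.adj
    have h2 : {e | G.IsLink e a b} = {e | G.IsLink e a b ∧ e ∈ E(t)} ∪
        {e | G.IsLink e a b ∧ e ∉ E(t)} := by
      ext e'; simp only [mem_ofPred_eq, mem_union]; tauto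
    rw [h2, edgeSum_union p (disjoint_left.2 fun x hx hx' ↦ hx'.2 hx.2)] at h1
    have h3 := ht {e | G.IsLink e a b ∧ e ∉ E(t)} fun e' he' ↦
      (excludes_iff he'.1).2 ⟨he'.2, hat, hbt⟩
    have h4 : edgeSum p {e | G.IsLink e a b ∧ e ∈ E(t)} =
        ∑ e' ∈ {e' : E(G) | (e' : β) ∈ Z} with ends G e' = ends G e, p.2 e' := by
      refine edgeSum_eq_sum p fun e' ↦ ?_
      rw [Finset.mem_filter, Finset.mem_filter, and_iff_right (Finset.mem_univ _), mem_ofPred_eq]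
      refine Iff.symm ?_
      rw [(isLink_iff_ends e).1 hab, ← isLink_iff_ends]
      constructor
      · rintro ⟨hl, he't⟩
        have he's : (e' : β) ∉ E(s) := fun h ↦ hX' e' hl ⟨h, he't⟩
        refine ⟨⟨(mem_edgeSet_subgraph hl).2 ⟨⟨he't, .inr fun x y hxy ↦ ?_⟩, ⟨has, hat⟩, hbs, hbt⟩,
          he's⟩, hl⟩
        obtain ⟨rfl, rfl⟩ | ⟨rfl, rfl⟩ := hl.eq_and_eq_or_eq_and_eq hxy
        · exact ⟨hne, hX'⟩
        · exact ⟨hne.symm, fun e'' h'' ↦ hX' e'' h''.symm⟩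
      · rintro ⟨h, hl⟩
        exact ⟨hl, ((mem_edgeSet_subgraph hl).1 h.1).1.1⟩
    rw [← h4]
    rw [scale] at h1
    linarith
  have hsum : edgeSum p Z = ∑ b ∈ Finset.image (ends G) {e' : E(G) | (e' : β) ∈ Z},
      ∑ e' ∈ {e' : E(G) | (e' : β) ∈ Z} with ends G e' = b, p.2 e' := by
    rw [edgeSum_eq_sum p (F := {e' : E(G) | (e' : β) ∈ Z}) (by simp)]
    exact (Finset.sum_fiberwise_of_maps_to (fun x hx ↦ Finset.mem_image_of_mem _ hx) _).symm
  obtain ⟨e, he⟩ := nonempty_iff_ne_empty.2 hne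
  have heG : e ∈ E(G) := (meet_le_right htG).edgeSet_mono.trans htG.edgeSet_mono he.1
  have hkey : ∀ b ∈ Finset.image (ends G) {e' : E(G) | (e' : β) ∈ Z}, 3 * (size G : ℝ) ^ 2 ≤
      ∑ e' ∈ {e' : E(G) | (e' : β) ∈ Z} with ends G e' = b, p.2 e' := by
    intro b hb
    obtain ⟨e', he', rfl⟩ := Finset.mem_image.1 hb
    exact key e' (Finset.mem_filter.1 he').2
  have hmem : ends G ⟨e, heG⟩ ∈ Finset.image (ends G) {e' : E(G) | (e' : β) ∈ Z} :=
    Finset.mem_image_of_mem _ (by simpa using he)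
  rw [hsum]
  refine (hkey _ hmem).trans (Finset.single_le_sum
    (f := fun b ↦ ∑ e' ∈ {e' : E(G) | (e' : β) ∈ Z} with ends G e' = b, p.2 e')
    (fun b hb ↦ le_trans (by positivity) (hkey b hb)) hmem)

end Sizes

end Pseudograph

/-! ### Uncrossing, and the tight tubes at a point. -/

namespace Pseudograph

open Set
open scoped Classical

set_option linter.unusedSectionVars false

variable {α β : Type*} {G R s t r H K K₁ K₂ C : Graph α β} [Fintype V(G)] [Fintype E(G)]
  {p : Space G}

/-! ### Uncrossing -/

theorem tubeFunctional_nonneg_of_components (hH : MeetsBundles G H) (hHG : H ≤ G)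
    (h : ∀ C : Graph α β, C.IsClosedSubgraph H → IsConnected C → 0 ≤ tubeFunctional G C p) :
    0 ≤ tubeFunctional G H p := by
  rcases eq_empty_or_nonempty V(H) with he | hne
  · rw [tubeFunctional_eq_zero_of_isEmpty he]
  refine closed_induction (P := fun K ↦ 0 ≤ tubeFunctional G K p)
    ((toFinite V(G)).subset hHG.vertexSet_mono) hne h ?_
  intro K K₁ K₂ hK h₁ h₂ _ _ hun hdis ih₁ ih₂
  rw [tubeFunctional_split (hH.of_isClosedSubgraph hK) h₁ h₂ hun hdis (hK.le.trans hHG)]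
  exact add_nonneg ih₁ ih₂

theorem nonempty_of_isTube (h : IsTube G t) : V(G).Nonempty :=
  h.connected.1.mono h.lt.le.vertexSet_mono

/-- Two tubes that violate or attain their inequalities are compatible, unless their join or a
component of their meet violates its inequality. -/
theorem uncross (hs : IsTube G s) (ht : IsTube G t)
    (hst : ¬ WeaklyCompatible G s t) (hs0 : slack p s ≤ 0) (ht0 : slack p t ≤ 0)
    (hQ : edgeSum p (crossEdges G R s t) ≤ (size G : ℝ) ^ 2)
    (hZ : E(meet G s t) \ E(s) = ∅ ∨
      3 * (size G : ℝ) ^ 2 ≤ edgeSum p (E(meet G s t) \ E(s))) :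
    slack p (join G R s t) < 0 ∨
      ∃ C : Graph α β, C.IsClosedSubgraph (meet G s t) ∧ IsConnected C ∧ slack p C < 0 := by
  by_contra! hcon
  obtain ⟨hj, hm⟩ := hcon
  have hsG := hs.lt.le
  have htG := ht.lt.le
  have hne := nonempty_of_isTube hs
  have hc := four_le_scale hne
  have hN : (1 : ℝ) ≤ size G := by exact_mod_cast size_pos hne
  have hid := tubeFunctional_join_add_meet (R := R) hsG htG p
  have hmb := meetsBundles_meet (s := s) htG ht.adj
  have hmG : meet G s t ≤ G := meet_le_self hsG
  have hfin : ∀ {X : Graph α β}, X ≤ G → V(X).Finite := fun hX ↦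
    (toFinite V(G)).subset hX.vertexSet_mono
  have hZ0 : 0 ≤ edgeSum p (E(meet G s t) \ E(s)) := by
    obtain h | h := hZ
    · rw [h, edgeSum_empty]
    · exact le_trans (by positivity) h
  simp only [slack] at hs0 ht0 hj hm
  have hcard := ncard_union_add_ncard_inter V(s) V(t) (hfin hsG) (hfin htG)
  -- If the node sets are nested, there are no cross edges, the meet is connected, and the powers of
  -- $c$ cancel.
  by_cases hnest : V(s) ⊆ V(t) ∨ V(t) ⊆ V(s)
  · have hcon : IsConnected (meet G s t) := by
      obtain h | h := hnest
      · exact hmb.isConnected hs.connected hsG (by simp [inter_eq_left.2 h])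
      · exact hmb.isConnected ht.connected htG (by simp [inter_eq_right.2 h])
    have hm := hm _ .rfl hcon
    have hcross : crossEdges G R s t = ∅ := by
      refine eq_empty_of_forall_notMem ?_
      rintro e ⟨-, a, b, -, ha, hb, h1, h2⟩
      obtain h | h := hnest
      · rw [union_eq_right.2 h] at ha hb
        exact h2 ⟨ha, hb⟩
      · rw [union_eq_left.2 h] at ha hb
        exact h1 ⟨ha, hb⟩
    rw [hcross, edgeSum_empty] at hid
    have hpow : scale G ^ V(join G R s t).ncard + scale G ^ V(meet G s t).ncard =
        scale G ^ V(s).ncard + scale G ^ V(t).ncard := by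
      simp only [vertexSet_join, vertexSet_meet]
      obtain h | h := hnest
      · rw [union_eq_right.2 h, inter_eq_left.2 h, add_comm]
      · rw [union_eq_left.2 h, inter_eq_right.2 h]
    simp only [depth] at hs0 ht0 hj hm
    obtain hZ | hZ := hZ
    · rw [hZ, edgeSum_empty] at hid
      have hEm : E(meet G s t) = E(s) ∩ E(t) := by
        refine subset_antisymm (subset_inter ?_ (meet_le_right htG).edgeSet_mono) ?_
        · exact sdiff_eq_empty.1 hZ
        · rintro e ⟨he, he'⟩
          obtain ⟨a, b, hab⟩ := Graph.exists_isLink_of_mem_edgeSet (hsG.edgeSet_mono he)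
          have h1 := mem_of_mem_edgeSet hsG hab he
          have h2 := mem_of_mem_edgeSet htG hab he'
          exact (mem_edgeSet_subgraph hab).2 ⟨⟨he', .inl he⟩, ⟨h1.1, h2.1⟩, h1.2, h2.2⟩
      have hEj : E(join G R s t) = E(s) ∪ E(t) := by
        refine subset_antisymm ?_ (union_subset (left_le_join hsG).edgeSet_mono
          (right_le_join htG).edgeSet_mono)
        intro e he
        obtain ⟨a, b, hab⟩ := Graph.exists_isLink_of_mem_edgeSet
          ((join_le_self hsG htG).edgeSet_mono he)
        obtain ⟨h | h | h, ha, hb⟩ := (mem_edgeSet_join hab).1 he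
        · exact .inl h
        · exact .inr h
        · obtain hn | hn := hnest
          · rw [union_eq_right.2 hn] at ha hb
            exact absurd ⟨ha, hb⟩ h.2.2
          · rw [union_eq_left.2 hn] at ha hb
            exact absurd ⟨ha, hb⟩ h.2.1
      have hcardE := ncard_union_add_ncard_inter E(s) E(t)
        ((toFinite E(G)).subset hsG.edgeSet_mono) ((toFinite E(G)).subset htG.edgeSet_mono)
      have hsize : size (join G R s t) + size (meet G s t) = size s + size t := by
        simp only [size, hEm, hEj, vertexSet_join, vertexSet_meet]
        omega
      have h1 : size s < size (join G R s t) := by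
        refine size_lt_size (lt_of_le_of_ne (left_le_join hsG) fun h ↦ ?_) (join_le_self hsG htG)
        exact hst (.inr (.inl ((right_le_join htG).trans h.ge)))
      have h2 : size t < size (join G R s t) := by
        refine size_lt_size (lt_of_le_of_ne (right_le_join htG) fun h ↦ ?_) (join_le_self hsG htG)
        exact hst (.inl ((left_le_join hsG).trans h.ge))
      have hsize' : (size (meet G s t) : ℝ) = size s + size t - size (join G R s t) := by
        rw [eq_sub_iff_add_eq, add_comm]
        exact_mod_cast hsize
      have h1' : (size s : ℝ) < size (join G R s t) := by exact_mod_cast h1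
      have h2' : (size t : ℝ) < size (join G R s t) := by exact_mod_cast h2
      rw [hsize'] at hm
      -- Sizes are modular here, so the squares for join and meet exceed those for $s$ and $t$ by
      -- $2(|join|-|s|)(|join|-|t|)>0$.
      nlinarith [mul_pos (sub_pos.2 h1') (sub_pos.2 h2')]
    -- Otherwise the extra $3N^2$ exceeds the two squares in the depths of `s` and `t`, which total
    -- at most $2N^2$.
    · have h1 := sq_sub_size_le hsG
      have h2 := sq_sub_size_le htG
      nlinarith [sq_nonneg ((size G : ℝ) - size (join G R s t)),
        sq_nonneg ((size G : ℝ) - size (meet G s t))]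
  -- The join now has more nodes than `s` and than `t`. With $m+1$ nodes in the join, the left side
  -- of the identity is at most $2c^m+\frac34c<4c^m\le c^{m+1}$, so for the meet nonnegativity
  -- suffices.
  · push Not at hnest
    have hm0 : 0 ≤ tubeFunctional G (meet G s t) p := by
      refine tubeFunctional_nonneg_of_components hmb hmG fun C hC hCc ↦ ?_
      have h1 := hm C hC hCc
      have h2 := le_depth (G := G) C
      have h3 : 0 ≤ scale G ^ V(C).ncard := by positivity
      linarith
    have hV1 : V(s).ncard < V(join G R s t).ncard := ncard_lt_ncard
      ⟨subset_union_left, fun h ↦ hnest.2 (subset_union_right.trans h)⟩ (hfin (join_le_self hsG htG))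
    have hV2 : V(t).ncard < V(join G R s t).ncard := ncard_lt_ncard
      ⟨subset_union_right, fun h ↦ hnest.1 (subset_union_left.trans h)⟩ (hfin (join_le_self hsG htG))
    have hV0 := (ncard_pos (hfin hsG)).2 hs.connected.1
    have hdj := le_depth (G := G) (join G R s t)
    obtain ⟨m, hm'⟩ : ∃ m, V(join G R s t).ncard = m + 1 := ⟨V(join G R s t).ncard - 1, by omega⟩
    rw [hm', pow_succ] at hdj
    have hc1 : 1 ≤ scale G := by linarith
    have hp1 : scale G ^ V(s).ncard ≤ scale G ^ m := pow_le_pow_right₀ hc1 (by omega)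
    have hp2 : scale G ^ V(t).ncard ≤ scale G ^ m := pow_le_pow_right₀ hc1 (by omega)
    have hp3 : scale G ≤ scale G ^ m := le_self_pow₀ hc1 (by omega)
    have hd1 := depth_le hsG
    have hd2 := depth_le htG
    have hsc : (size G : ℝ) ^ 2 = scale G / 4 := by rw [scale]; ring
    rw [hsc] at hd1 hd2 hQ
    nlinarith

/-! ### The components cannot all attain their inequalities -/

/-- The factor $5/4$ absorbs the square in the depth, which is at most $N^2=c/4$. It survives
disjoint unions because $a+b\le ab$ for $a,b\ge 4$. -/
theorem tubeFunctional_le_of_components (hHG : H.IsClosedSubgraph G) (hne : V(H).Nonempty)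
    (h : ∀ C : Graph α β, IsComponent G C → slack p C ≤ 0) :
    tubeFunctional G H p ≤ 5 / 4 * scale G ^ V(H).ncard := by
  have hc := four_le_scale (hne.mono hHG.vertexSet_mono)
  have hc1 : 1 ≤ scale G := by linarith
  have hfin : ∀ {X : Graph α β}, X ≤ G → V(X).Finite := fun hX ↦
    (toFinite V(G)).subset hX.vertexSet_mono
  refine closed_induction (P := fun K ↦ tubeFunctional G K p ≤ 5 / 4 * scale G ^ V(K).ncard)
    (hfin hHG.le) hne ?_ ?_
  · intro C hC hcon
    have hCG := hC.trans hHG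
    have h1 := h C (isComponent_of_isClosedSubgraph hCG hcon)
    have h2 := depth_le hCG.le
    have h3 : scale G ≤ scale G ^ V(C).ncard :=
      le_self_pow₀ hc1 ((ncard_pos (hfin hCG.le)).2 hcon.1).ne'
    have hsc : (size G : ℝ) ^ 2 = scale G / 4 := by rw [scale]; ring
    rw [slack] at h1
    linarith
  · intro K K₁ K₂ hK h₁ h₂ hne₁ hne₂ hun hdis ih₁ ih₂
    have hKG := hK.trans hHG
    have hf₁ := hfin (h₁.trans hKG).le
    have hf₂ := hfin (h₂.trans hKG).le
    rw [tubeFunctional_split ((meetsBundles_self G).of_isClosedSubgraph hKG) h₁ h₂ hun hdis hKG.le,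
      ← hun, ncard_union_eq hdis hf₁ hf₂, pow_add]
    have h3 : scale G ≤ scale G ^ V(K₁).ncard := le_self_pow₀ hc1 ((ncard_pos hf₁).2 hne₁).ne'
    have h4 : scale G ≤ scale G ^ V(K₂).ncard := le_self_pow₀ hc1 ((ncard_pos hf₂).2 hne₂).ne'
    nlinarith

/-- If $G$ is connected, it is its own component and not a tube. Otherwise split it into unions of
components with $a=c^{k_1}$ and $b=c^{k_2}$: the node sum $ab$ would be at most $\frac54(a+b)$,
impossible for $a,b\ge4$. -/
theorem not_forall_isComponent_slack_nonpos (hne : V(G).Nonempty) (hp : InSpan p) :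
    ¬ ∀ C, IsComponent G C → IsTube G C ∧ slack p C ≤ 0 := by
  intro h
  by_cases hcon : IsConnected G
  · exact (h G (isComponent_of_isClosedSubgraph .rfl hcon)).1.lt.false
  obtain ⟨K₁, K₂, h₁, h₂, hne₁, hne₂, hun, hdis⟩ := exists_split_of_not_isConnected hne hcon
  have hc := four_le_scale hne
  have hc1 : 1 ≤ scale G := by linarith
  have h3 := tubeFunctional_le_of_components h₁ hne₁ fun C hC ↦ (h C hC).2
  have h4 := tubeFunctional_le_of_components h₂ hne₂ fun C hC ↦ (h C hC).2
  have hf₁ := (toFinite V(G)).subset h₁.vertexSet_mono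
  have hf₂ := (toFinite V(G)).subset h₂.vertexSet_mono
  have h5 := tubeFunctional_split (meetsBundles_self G) h₁ h₂ hun hdis le_rfl p
  have h6 := hp.slack_self
  rw [slack, depth_self, ← hun, ncard_union_eq hdis hf₁ hf₂, pow_add] at h6
  have h7 : scale G ≤ scale G ^ V(K₁).ncard := le_self_pow₀ hc1 ((ncard_pos hf₁).2 hne₁).ne'
  have h8 : scale G ≤ scale G ^ V(K₂).ncard := le_self_pow₀ hc1 ((ncard_pos hf₂).2 hne₂).ne'
  nlinarith

/-! ### The tubes tight at a point -/

/-- The tubes whose inequalities are attained at `p`. -/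
def tightTubes (p : Space G) : Set (Graph α β) := {t | IsTube G t ∧ slack p t = 0}

theorem slack_nonneg_of_mem (hp : p ∈ associahedron G) (ht : IsWeakTube G t) : 0 ≤ slack p t := by
  rw [mem_associahedron_iff] at hp
  by_cases h : t = G
  · rw [h, hp.1.slack_self]
  · exact sub_nonneg.2 (hp.2 t (ht.isTube h))

/-- Uncrossing with `R = G` leaves no cross edges, and at a point of the associahedron neither the
join nor a component of the meet can have negative slack. -/
theorem isTubing_tightTubes (hne : V(G).Nonempty) (hp : p ∈ associahedron G) :
    IsTubing G (tightTubes p) := by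
  have hspan := (mem_associahedron_iff.1 hp).1
  refine ⟨fun t ht ↦ ht.1, ?_, fun h ↦ not_forall_isComponent_slack_nonpos hne hspan
    fun C hC ↦ ⟨(h C hC).1, (h C hC).2.le⟩⟩
  rintro s ⟨hs, hs0⟩ t ⟨ht, ht0⟩ hst
  refine WeaklyCompatible.tubeCompatible ?_ hst
  by_contra hcomp
  have hZ := edgeSum_meet_diff (s := s) ht.lt.le hspan fun Q hQ ↦
    edgeSum_le_of_slack ht.lt.le hQ ht0.le (slack_nonneg_of_mem hp
      (ht.isWeakTube.of_le (le_addEdges ht.lt.le Q) (addEdges_le ht.lt.le Q) rfl))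
  obtain h | ⟨C, hC, hCc, h⟩ := uncross (R := G) hs ht hcomp hs0.le ht0.le
    (by rw [crossEdges_self, edgeSum_empty]; positivity) hZ
  · exact absurd (slack_nonneg_of_mem hp (isWeakTube_join hs.isWeakTube ht.isWeakTube
      (meetsBundles_self G) le_rfl hs.lt.le ht.lt.le hcomp)) h.not_ge
  · exact absurd (slack_nonneg_of_mem hp (isWeakTube_component_meet hs.lt.le ht.isWeakTube hC hCc))
      h.not_ge

end Pseudograph

/-! ### Maximal tubings: validity of all other inequalities, and linear independence. -/

namespace Pseudograph

open Set
open scoped Classical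

set_option linter.unusedSectionVars false

variable {α β : Type*} {G R s t r H K K₁ K₂ C : Graph α β} [Fintype V(G)] [Fintype E(G)]
  {p : Space G} {T M : Set (Graph α β)}

/-! ### Tubings -/

theorem finite_subgraphs (G : Graph α β) [Fintype V(G)] [Fintype E(G)] :
    {t : Graph α β | t ≤ G}.Finite := by
  refine Finite.of_finite_image (f := fun t ↦ (V(t), E(t)))
    (((toFinite V(G)).finite_subsets.prod (toFinite E(G)).finite_subsets).subset ?_) ?_
  · rintro _ ⟨t, ht, rfl⟩
    exact ⟨ht.vertexSet_mono, ht.edgeSet_mono⟩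
  · intro s hs t ht h
    rw [Prod.mk.injEq] at h
    exact (Graph.Compatible.of_le_le hs ht).ext h.1 h.2

theorem IsTubing.finite (hT : IsTubing G T) : T.Finite :=
  (finite_subgraphs G).subset fun t ht ↦ (hT.isTube t ht).lt.le

theorem finite_tubes (G : Graph α β) [Fintype V(G)] [Fintype E(G)] :
    {t : Graph α β | IsTube G t}.Finite :=
  (finite_subgraphs G).subset fun _ ht ↦ ht.lt.le

theorem IsTubing.subset {S : Set (Graph α β)} (hT : IsTubing G T) (h : S ⊆ T) : IsTubing G S :=
  ⟨fun t ht ↦ hT.isTube t (h ht), hT.pairwise.mono h,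
    fun hC ↦ hT.not_all_components fun C hc ↦ h (hC C hc)⟩

theorem IsTubing.weaklyCompatible (hT : IsTubing G T) (hs : s ∈ T) (ht : t ∈ T) :
    WeaklyCompatible G s t := by
  by_cases h : s = t
  · exact .inl h.le
  · exact (hT.pairwise hs ht h).weaklyCompatible

theorem IsTubing.weaklyCompatible_insert (hT : IsTubing G T) (hs : s ∈ insert G T)
    (ht : t ∈ insert G T) : WeaklyCompatible G s t := by
  obtain rfl | hs := hs
  · obtain rfl | ht := ht
    · exact .inl le_rfl
    · exact .inr (.inl (hT.isTube t ht).lt.le)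
  · obtain rfl | ht := ht
    · exact .inl (hT.isTube s hs).lt.le
    · exact hT.weaklyCompatible hs ht

theorem IsTubing.le_of_mem_insert (hT : IsTubing G T) (hs : s ∈ insert G T) : s ≤ G := by
  obtain rfl | hs := hs
  · exact le_rfl
  · exact (hT.isTube s hs).lt.le

theorem IsTubing.meetsBundles_of_mem_insert (hT : IsTubing G T) (hs : s ∈ insert G T) :
    MeetsBundles G s := by
  obtain rfl | hs := hs
  · exact meetsBundles_self _
  · exact (hT.isTube s hs).adj

/-- Among the members of a tubing and the whole graph, those with a property that forces a common
node have a least element. -/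
theorem IsTubing.exists_least (hT : IsTubing G T) {P : Graph α β → Prop} (hPG : P G) {v : α}
    (hv : ∀ r, P r → v ∈ V(r)) :
    ∃ R ∈ insert G T, P R ∧ ∀ r ∈ insert G T, P r → R ≤ r := by
  obtain ⟨R, hR⟩ := ((hT.finite.insert G).sep P).exists_minimal ⟨G, mem_insert _ _, hPG⟩
  refine ⟨R, hR.prop.1, hR.prop.2, fun r hr hPr ↦ ?_⟩
  obtain h | h := (hT.weaklyCompatible_insert hR.prop.1 hr).le_or_le (hv R hR.prop.2) (hv r hPr)
  · exact h
  · exact hR.le_of_le ⟨hr, hPr⟩ h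

/-! ### The points where all inequalities of a maximal tubing are attained -/

/-- By maximality it suffices that `insert s M` is a tubing. It cannot contain all components of
`G`, because all its members have slack at most zero. -/
theorem mem_of_weaklyCompatible (hM : Maximal (IsTubing G) M) (hp : InSpan p)
    (hM0 : ∀ t ∈ M, slack p t = 0) (hs : IsTube G s) (hs0 : slack p s ≤ 0)
    (hcomp : ∀ r ∈ M, WeaklyCompatible G r s) : s ∈ M := by
  have h : IsTubing G (insert s M) := by
    refine ⟨?_, ?_, fun h ↦ not_forall_isComponent_slack_nonpos (nonempty_of_isTube hs) hp
      fun C hC ↦ ?_⟩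
    · rintro t (rfl | ht)
      · exact hs
      · exact hM.prop.isTube t ht
    · refine hM.prop.pairwise.insert fun r hr hne ↦ ⟨?_, ?_⟩
      · exact (hcomp r hr).symm.tubeCompatible hne
      · exact (hcomp r hr).tubeCompatible hne.symm
    · obtain rfl | h := h C hC
      · exact ⟨hs, hs0⟩
      · exact ⟨hM.prop.isTube C h, (hM0 C h).le⟩
  exact hM.le_of_ge h (subset_insert s M) (mem_insert s M)

/-- Uncrossing with the members of a maximal tubing. -/
theorem crossing_induction (hM : Maximal (IsTubing G) M) (hp : InSpan p)
    (hM0 : ∀ t ∈ M, slack p t = 0) {P : Graph α β → Prop}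
    (step : ∀ s, IsTube G s → P s → slack p s ≤ 0 → ∀ t ∈ M, ¬ WeaklyCompatible G s t →
      ∃ w, IsWeakTube G w ∧ P w ∧ slack p w < 0 ∧ WeaklyCompatible G t w ∧
        ∀ r ∈ M, WeaklyCompatible G r s → WeaklyCompatible G r w)
    (hs : IsTube G s) (hP : P s) (hs0 : slack p s ≤ 0) : s ∈ M := by
  -- The number of members of `M` incompatible with `s` drops at each step: compatible members stay
  -- compatible, and `t` becomes compatible.
  induction hn : {r ∈ M | ¬ WeaklyCompatible G r s}.ncard using Nat.strong_induction_on
    generalizing s with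
  | _ n ih =>
    by_cases hcomp : ∀ r ∈ M, WeaklyCompatible G r s
    · exact mem_of_weaklyCompatible hM hp hM0 hs hs0 hcomp
    push Not at hcomp
    obtain ⟨t, ht, hts⟩ := hcomp
    obtain ⟨w, hw, hPw, hw0, htw, hmono⟩ := step s hs hP hs0 t ht fun h ↦ hts h.symm
    have hwG : w ≠ G := by
      rintro rfl
      exact hw0.ne hp.slack_self
    have hlt : {r ∈ M | ¬ WeaklyCompatible G r w}.ncard < n := by
      rw [← hn]
      refine ncard_lt_ncard ⟨fun r hr ↦ ⟨hr.1, fun h ↦ hr.2 (hmono r hr.1 h)⟩, fun h ↦ ?_⟩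
        (hM.prop.finite.subset fun r hr ↦ hr.1)
      exact (h ⟨ht, hts⟩).2 htw
    -- The induction hypothesis puts `w` into `M`, where slacks vanish, against its negative slack.
    -- So the step can never have been needed.
    exact absurd (hM0 w (ih _ hlt (hw.isTube hwG) hPw hw0.le rfl)) hw0.ne

theorem join_le_of_subset (hs : s ≤ r) (ht : t ≤ r) (hr : r ≤ G) (hV : V(s) ⊆ V(t)) :
    join G R s t ≤ r := by
  refine ⟨union_subset hs.vertexSet_mono ht.vertexSet_mono, ?_⟩
  rintro e x y ⟨⟨h | h | h, hxy⟩, hx, hy⟩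
  · exact (hr.isLink_iff (hs.edgeSet_mono h)).2 hxy
  · exact (hr.isLink_iff (ht.edgeSet_mono h)).2 hxy
  · rw [union_eq_right.2 hV] at hx hy
    exact absurd ⟨hx, hy⟩ (h.2 x y hxy).2

/-- The inequalities of the graphs obtained by adding edges to members of the tubing hold. -/
theorem mem_of_le_of_vertexSet_eq (hM : Maximal (IsTubing G) M) (hp : InSpan p)
    (hM0 : ∀ t ∈ M, slack p t = 0) (hs : IsTube G s)
    (hP : ∃ t₀ ∈ M, t₀ ≤ s ∧ V(t₀) = V(s)) (hs0 : slack p s ≤ 0) : s ∈ M := by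
  -- Bounds on edge sums at `p` are not yet known. This family needs none: below, both correction
  -- terms of the uncrossing identity vanish, and the family is closed under uncrossing.
  refine crossing_induction hM hp hM0 (P := fun s ↦ ∃ t₀ ∈ M, t₀ ≤ s ∧ V(t₀) = V(s)) ?_ hs hP hs0
  clear hs0 hP hs
  rintro s hs ⟨t₀, ht₀, h₀s, hV⟩ hs0 t ht hst
  have htube := hM.prop.isTube t ht
  have h₀tube := hM.prop.isTube t₀ ht₀
  have hsG := hs.lt.le
  have htG := htube.lt.le
  have h₀t : t₀ ≤ t := by
    obtain h | h | h := hM.prop.weaklyCompatible ht₀ ht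
    · exact h
    · exact absurd (.inr (.inl (h.trans h₀s))) hst
    · exact absurd (WeaklyCompatible.anti_separated h hV.ge subset_rfl) hst
  have hVst : V(s) ⊆ V(t) := hV ▸ h₀t.vertexSet_mono
  -- The common subgraph `t₀` supplies a common edge of `s` and `t` in every bundle between nodes of
  -- `s`.
  have hZ : E(meet G s t) \ E(s) = ∅ := by
    refine eq_empty_of_forall_notMem ?_
    rintro e ⟨⟨a, b, ⟨⟨-, h⟩, hab⟩, ⟨ha, -⟩, hb, -⟩, hes⟩
    obtain ⟨hne, h⟩ := h.resolve_left hes a b hab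
    obtain ⟨e', he'⟩ := h₀tube.adj a (hV ▸ ha) b (hV ▸ hb) hne hab.adj
    exact h e' (he'.mono h₀tube.lt.le)
      ⟨h₀s.edgeSet_mono he'.edge_mem, h₀t.edgeSet_mono he'.edge_mem⟩
  obtain h | ⟨C, hC, hCc, h⟩ := uncross (R := G) hs htube hst hs0 (hM0 t ht).le
    (by rw [crossEdges_self, edgeSum_empty]; positivity) (.inl hZ)
  · refine ⟨_, isWeakTube_join hs.isWeakTube htube.isWeakTube (meetsBundles_self G) le_rfl hsG htG
      hst, ⟨t, ht, right_le_join htG, by simp [union_eq_right.2 hVst]⟩, h,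
      .inl (right_le_join htG), fun r hr hrs ↦ weaklyCompatible_join hsG htG hst
        (fun h1 h2 ↦ join_le_of_subset h1 h2 (hM.prop.isTube r hr).lt.le hVst) hrs
        (hM.prop.weaklyCompatible hr ht)⟩
  · have h₀m : t₀ ≤ meet G s t := le_meet h₀tube.lt.le h₀s h₀t
    have hVC : V(t₀) ⊆ V(C) := by
      obtain ⟨x, hx⟩ := hCc.1
      have hx₀ : x ∈ V(t₀) := hV ▸ (hC.vertexSet_mono hx).1
      exact fun y hy ↦ mem_of_reflTransGen
        (fun a b hab ha ↦ (hC.mem_iff_of_adj (hab.mono h₀m)).1 ha) hx (h₀tube.connected.2 x hx₀ y hy)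
    refine ⟨C, isWeakTube_component_meet hsG htube.isWeakTube hC hCc,
      ⟨t₀, ht₀, hC.isInducedSubgraph.le_of_le_subset h₀m hVC, hVC.antisymm fun x hx ↦
        hV ▸ (hC.vertexSet_mono hx).1⟩, h, .inr (.inl (hC.le.trans (meet_le_right htG))),
      fun r hr hrs ↦ ?_⟩
    have hrt := hM.prop.isTube r hr
    exact weaklyCompatible_component_meet hrt.lt.le hrt.connected htG htube.adj hC hst hrs
      (hM.prop.weaklyCompatible hr ht)

/-- The preceding theorem applies to `t` with `Q` added. The resulting bound controls both
correction terms when arbitrary tubes are uncrossed. -/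
theorem edgeSum_le_of_mem (hM : Maximal (IsTubing G) M) (hp : InSpan p)
    (hM0 : ∀ t ∈ M, slack p t = 0) (ht : t ∈ M) {Q : Set β} (hQ : ∀ e ∈ Q, Excludes G t e) :
    edgeSum p Q ≤ (size G : ℝ) ^ 2 := by
  have htube := hM.prop.isTube t ht
  refine edgeSum_le_of_slack htube.lt.le hQ (hM0 t ht).le ?_
  by_contra! h
  have hw : IsWeakTube G (addEdges G t Q) :=
    htube.isWeakTube.of_le (le_addEdges htube.lt.le Q) (addEdges_le htube.lt.le Q) rfl
  have hwG : addEdges G t Q ≠ G := fun hG ↦ h.ne (by rw [hG, hp.slack_self])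
  exact h.ne (hM0 _ (mem_of_le_of_vertexSet_eq hM hp hM0 (hw.isTube hwG)
    ⟨t, ht, le_addEdges htube.lt.le Q, rfl⟩ h.le))

/-- A point of the span that attains the inequalities of a maximal tubing strictly satisfies those
of all other tubes. -/
theorem mem_of_slack_nonpos (hM : Maximal (IsTubing G) M) (hp : InSpan p)
    (hM0 : ∀ t ∈ M, slack p t = 0) (hs : IsTube G s) (hs0 : slack p s ≤ 0) : s ∈ M := by
  refine crossing_induction hM hp hM0 (P := fun _ ↦ True) ?_ hs trivial hs0
  clear hs0 hs
  intro s hs _ hs0 t ht hst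
  have htube := hM.prop.isTube t ht
  have hsG := hs.lt.le
  have htG := htube.lt.le
  obtain ⟨v, hv⟩ := hs.connected.1
  -- Choosing `R` least keeps the join below every member that contains `s` and `t`. The price is
  -- the cross edges outside `R`; they are excluded by `R`, so their sum is at most $N^2$.
  obtain ⟨R, hR, ⟨hsR, htR⟩, hmin⟩ := hM.prop.exists_least (P := fun r ↦ s ≤ r ∧ t ≤ r)
    ⟨hsG, htG⟩ (fun r hr ↦ hr.1.vertexSet_mono hv)
  have hRG := hM.prop.le_of_mem_insert hR
  have hRb := hM.prop.meetsBundles_of_mem_insert hR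
  have hQ : edgeSum p (crossEdges G R s t) ≤ (size G : ℝ) ^ 2 := by
    obtain rfl | hR := hR
    · rw [crossEdges_self, edgeSum_empty]; positivity
    · exact edgeSum_le_of_mem hM hp hM0 hR (crossEdges_subset_excludes hsR htR)
  obtain h | ⟨C, hC, hCc, h⟩ := uncross hs htube hst hs0 (hM0 t ht).le hQ
    (edgeSum_meet_diff htG hp fun Q hQ ↦ edgeSum_le_of_mem hM hp hM0 ht hQ)
  · exact ⟨_, isWeakTube_join hs.isWeakTube htube.isWeakTube hRb hRG hsR htR hst, trivial, h,
      .inl (right_le_join htG), fun r hr hrs ↦ weaklyCompatible_join hsG htG hst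
        (fun h1 h2 ↦ (join_le hRG hsR htR).trans (hmin r (.inr hr) ⟨h1, h2⟩)) hrs
        (hM.prop.weaklyCompatible hr ht)⟩
  · refine ⟨C, isWeakTube_component_meet hsG htube.isWeakTube hC hCc, trivial, h,
      .inr (.inl (hC.le.trans (meet_le_right htG))), fun r hr hrs ↦ ?_⟩
    have hrt := hM.prop.isTube r hr
    exact weaklyCompatible_component_meet hrt.lt.le hrt.connected htG htube.adj hC hst hrs
      (hM.prop.weaklyCompatible hr ht)

/-! ### Linear independence -/

/-- Every member of a tubing, and the whole graph, has a node in no smaller member, or an edge in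
no smaller member that some smaller member excludes. -/
theorem IsTubing.exists_new (hT : IsTubing G T) (ht : t ∈ insert G T) :
    (∃ v ∈ V(t), ∀ s ∈ insert G T, s < t → v ∉ V(s)) ∨
      ∃ e ∈ E(t), (∃ s ∈ insert G T, s < t ∧ Excludes G s e) ∧
        ∀ s ∈ insert G T, s < t → e ∉ E(s) := by
  have htG := hT.le_of_mem_insert ht
  -- For a member of `T` take `C = t`; for `G` take a component outside `T`, which exists by the
  -- last condition on tubings.
  obtain ⟨C, hCt, hCc, hC⟩ : ∃ C ≤ t, IsConnected C ∧ ∀ s ∈ insert G T, s < t → ¬ C ≤ s := by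
    obtain rfl | ht := ht
    · have := hT.not_all_components
      push Not at this
      obtain ⟨C, hC, hCT⟩ := this
      refine ⟨C, hC.prop.1, hC.prop.2, fun s hs hlt hCs ↦ ?_⟩
      have hsT : s ∈ T := hs.resolve_left hlt.ne
      have := hC.eq_of_le ⟨(hT.isTube s hsT).lt.le, (hT.isTube s hsT).connected⟩ hCs
      exact hCT (this ▸ hsT)
    · exact ⟨t, le_rfl, (hT.isTube t ht).connected, fun s _ hlt h ↦ (hlt.trans_le h).false⟩
  rw [or_iff_not_imp_left]
  intro hnode
  push Not at hnode
  have hVC : ∀ v ∈ V(C), ∃ s ∈ insert G T, s < t ∧ v ∈ V(s) := fun v hv ↦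
    hnode v (hCt.vertexSet_mono hv)
  obtain ⟨v, hv⟩ := hCc.1
  obtain ⟨s₀, hs₀, hs₀t, hvs₀⟩ := hVC v hv
  -- A maximal smaller member through `v` absorbs every smaller member it meets. If smaller members
  -- cover `C`, connectedness puts all nodes of `C` into `s`; an edge of `C` missing from `s` is
  -- then the required one.
  obtain ⟨s, hs⟩ := ((hT.finite.insert G).sep fun s ↦ s < t ∧ v ∈ V(s)).exists_maximal
    ⟨s₀, hs₀, hs₀t, hvs₀⟩
  obtain ⟨hsT, hst, hvs⟩ := hs.prop
  have hle : ∀ r ∈ insert G T, r < t → (∃ x ∈ V(r), x ∈ V(s)) → r ≤ s := by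
    rintro r hr hrt ⟨x, hxr, hxs⟩
    obtain h | h := (hT.weaklyCompatible_insert hr hsT).le_or_le hxr hxs
    · exact h
    · exact hs.le_of_ge ⟨hr, hrt, h.vertexSet_mono hvs⟩ h
  have hsub : V(C) ⊆ V(s) := by
    intro b hb
    by_contra hbs
    obtain ⟨x, hx, y, hy, hxy⟩ := hCc.exists_adj_of_mem_of_notMem hv hvs hb hbs
    obtain ⟨r, hr, hrt, hyr⟩ := hVC y hxy.right_mem
    obtain h | h | h := hT.weaklyCompatible_insert hr hsT
    · exact hy (h.vertexSet_mono hyr)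
    · exact hy ((hle r hr hrt ⟨x, h.vertexSet_mono hx, hx⟩).vertexSet_mono hyr)
    · exact h.2 y hyr x hx (hxy.symm.mono (hCt.trans htG))
  have hCs := hC s hsT hst
  rw [le_iff_of_le_of_le (hCt.trans htG) (hT.le_of_mem_insert hsT), not_and] at hCs
  obtain ⟨e, heC, hes⟩ := not_subset.1 (hCs hsub)
  have heG : e ∈ E(G) := (hCt.trans htG).edgeSet_mono heC
  obtain ⟨a, b, hab⟩ := Graph.exists_isLink_of_mem_edgeSet heG
  have habC := mem_of_mem_edgeSet (hCt.trans htG) hab heC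
  refine ⟨e, hCt.edgeSet_mono heC, ⟨s, hsT, hst, (excludes_iff hab).2
    ⟨hes, hsub habC.1, hsub habC.2⟩⟩, fun r hr hrt her ↦ hes ?_⟩
  have har := (mem_of_mem_edgeSet (hT.le_of_mem_insert hr) hab her).1
  exact (hle r hr hrt ⟨a, har, hsub habC.1⟩).edgeSet_mono her

/-- The functionals of the members of a tubing, the sum of the node coordinates and the sums over
the bundles are linearly independent. -/
theorem IsTubing.coeff_eq_zero (hT : IsTubing G T) {F : Finset (Graph α β)}
    (hF : ∀ t, t ∈ F ↔ t ∈ insert G T) {l : Graph α β → ℝ} {m : Sym2 α → ℝ}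
    (hnode : ∀ v ∈ V(G), (∑ t ∈ F, if v ∈ V(t) then l t else 0) = 0)
    (hedge : ∀ e a b, G.IsLink e a b →
      (∑ t ∈ F, if Excludes G t e then l t else 0) + (if a = b then 0 else m s(a, b)) = 0) :
    (∀ t ∈ F, l t = 0) ∧ ∀ a b, a ≠ b → G.Adj a b → m s(a, b) = 0 := by
  have hleast : ∀ a ∈ V(G), ∀ b ∈ V(G), ∃ R ∈ insert G T, (a ∈ V(R) ∧ b ∈ V(R)) ∧
      ∀ r ∈ insert G T, a ∈ V(r) ∧ b ∈ V(r) → R ≤ r := fun a ha b hb ↦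
    hT.exists_least (P := fun r ↦ a ∈ V(r) ∧ b ∈ V(r)) ⟨ha, hb⟩ (fun r hr ↦ hr.1)
  have hm : ∀ a b, a ≠ b → G.Adj a b → m s(a, b) = 0 := by
    intro a b hne hadj
    -- The least member containing both nodes has an edge of their bundle, and every other member
    -- containing both nodes has that edge too. Nobody excludes it, so its equation reads $m=0$.
    obtain ⟨R, hR, ⟨haR, hbR⟩, hmin⟩ := hleast a hadj.left_mem b hadj.right_mem
    obtain ⟨e, he⟩ := hT.meetsBundles_of_mem_insert hR a haR b hbR hne hadj
    have heG := he.mono (hT.le_of_mem_insert hR)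
    have h := hedge e a b heG
    rw [if_neg hne, Finset.sum_eq_zero, zero_add] at h
    · exact h
    · intro r hr
      refine if_neg fun hex ↦ ?_
      rw [excludes_iff heG] at hex
      exact hex.1 ((hmin r ((hF r).1 hr) hex.2).edgeSet_mono he.edge_mem)
  refine ⟨?_, hm⟩
  have hedge' : ∀ e a b, G.IsLink e a b → (∑ t ∈ F, if Excludes G t e then l t else 0) = 0 := by
    intro e a b hab
    have h := hedge e a b hab
    by_cases hne : a = b
    · simpa [hne] using h
    · simpa [hne, hm a b hne hab.adj] using h
  -- The sums over upper sets of the tubing vanish; at a maximal member with nonzero coefficient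
  -- such a sum is that coefficient alone.
  have hsum : ∀ n, ∀ t ∈ F, size t = n → (∑ r ∈ F, if t ≤ r then l r else 0) = 0 := by
    intro n
    induction n using Nat.strong_induction_on with
    | _ n ih =>
      intro t ht hn
      have htT := (hF t).1 ht
      have htG := hT.le_of_mem_insert htT
      obtain ⟨v, hv, hnew⟩ | ⟨e, het, ⟨s, hs, hst, hex⟩, hnew⟩ := hT.exists_new htT
      · refine (Finset.sum_congr rfl fun r hr ↦ if_congr ?_ rfl rfl).trans
          (hnode v (htG.vertexSet_mono hv))
        refine ⟨fun h ↦ h.vertexSet_mono hv, fun h ↦ ?_⟩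
        obtain h' | h' := (hT.weaklyCompatible_insert htT ((hF r).1 hr)).le_or_le hv h
        · exact h'
        · by_contra hcon
          exact hnew r ((hF r).1 hr) (lt_of_le_not_ge h' hcon) h
      · obtain ⟨a, b, hab⟩ := Graph.exists_isLink_of_mem_edgeSet (htG.edgeSet_mono het)
        obtain ⟨R, hR, ⟨haR, hbR⟩, hmin⟩ := hleast a hab.left_mem b hab.right_mem
        have hRt : R < t := (hmin s hs ((excludes_iff hab).1 hex).2).trans_lt hst
        have h1 := ih _ (hn ▸ size_lt_size hRt htG) R ((hF R).2 hR) rfl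
        have h2 := hedge' e a b hab
        have hmem := mem_of_mem_edgeSet htG hab het
        -- The members above `R` are those containing both ends of `e`. Each lies above `t`, or
        -- below `t` and excludes `e`.
        suffices h : (∑ r ∈ F, if R ≤ r then l r else 0) = (∑ r ∈ F, if t ≤ r then l r else 0) +
            ∑ r ∈ F, if Excludes G r e then l r else 0 by linarith
        rw [← Finset.sum_add_distrib]
        refine Finset.sum_congr rfl fun r hr ↦ ?_
        have hrT := (hF r).1 hr
        simp only [excludes_iff hab]
        by_cases htr : t ≤ r
        · simp [htr, hRt.le.trans htr, htr.edgeSet_mono het]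
        · by_cases hRr : R ≤ r
          · have har := hRr.vertexSet_mono haR
            have hbr := hRr.vertexSet_mono hbR
            have hrt : r < t := by
              obtain h | h := (hT.weaklyCompatible_insert hrT htT).le_or_le har hmem.1
              · exact lt_of_le_not_ge h htr
              · exact absurd h htr
            simp [htr, hRr, har, hbr, hnew r hrT hrt]
          · have : ¬ (a ∈ V(r) ∧ b ∈ V(r)) := fun h ↦ hRr (hmin r hrT h)
            simp [htr, hRr, this]
  by_contra! hcon
  obtain ⟨t₀, ht₀, hl₀⟩ := hcon
  obtain ⟨t, ht⟩ := (F.filter fun t ↦ l t ≠ 0).exists_maximal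
    ⟨t₀, Finset.mem_filter.2 ⟨ht₀, hl₀⟩⟩
  obtain ⟨htF, hlt⟩ := Finset.mem_filter.1 ht.prop
  have h := hsum _ t htF rfl
  rw [Finset.sum_eq_single t] at h
  · exact hlt (by simpa using h)
  · intro r hr hrt
    refine ite_eq_right_iff.2 fun hle ↦ ?_
    by_contra hl
    exact hrt ((ht.le_of_ge (Finset.mem_filter.2 ⟨hr, hl⟩) hle).antisymm hle)
  · exact fun h ↦ absurd htF h

end Pseudograph

/-! ### Faces of the associahedron and their dimensions. -/

namespace Pseudograph

open Set Filter Topology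
open scoped Classical

set_option linter.unusedSectionVars false

variable {α β : Type*} {G R s t r H K K₁ K₂ C : Graph α β} [Fintype V(G)] [Fintype E(G)]
  {p q : Space G} {S T M : Set (Graph α β)}

/-! ### The equations and inequalities as linear functionals -/

theorem _root_.LinearMap.pi_surjective_of_forall_sum_eq_zero {ι W : Type*} [Fintype ι]
    [AddCommGroup W] [Module ℝ W] (f : ι → W →ₗ[ℝ] ℝ)
    (hf : ∀ g : ι → ℝ, (∀ w, ∑ i, g i * f i w = 0) → g = 0) :
    Function.Surjective (LinearMap.pi f) := by
  rw [← LinearMap.range_eq_top]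
  by_contra hne
  obtain ⟨l, hl, hle⟩ := Submodule.exists_le_ker_of_lt_top _ (lt_top_iff_ne_top.2 hne)
  have hlsum : ∀ x : ι → ℝ, l x = ∑ i, l (Pi.single i 1) * x i := by
    intro x
    conv_lhs => rw [← Finset.univ_sum_single x, map_sum]
    refine Finset.sum_congr rfl fun i _ ↦ ?_
    rw [mul_comm, ← smul_eq_mul, ← map_smul, ← Pi.single_smul, smul_eq_mul, mul_one]
  have hg := hf (fun i ↦ l (Pi.single i 1)) fun w ↦ by
    have := hle (LinearMap.mem_range_self (LinearMap.pi f) w)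
    rw [LinearMap.mem_ker, hlsum] at this
    simpa using this
  refine hl (LinearMap.ext fun x ↦ ?_)
  rw [hlsum]
  exact Finset.sum_eq_zero fun i _ ↦ by rw [show l (Pi.single i 1) = 0 from congrFun hg i, zero_mul]

/-- The functional of a tube as a linear map. -/
def tubeLin (G : Graph α β) [Fintype V(G)] [Fintype E(G)] (t : Graph α β) :
    Space G →ₗ[ℝ] ℝ where
  toFun := tubeFunctional G t
  map_add' p q := by
    simp only [tubeFunctional_eq, nodeSum, edgeSum, Prod.fst_add, Prod.snd_add, Pi.add_apply]
    rw [add_add_add_comm]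
    simp only [← Finset.sum_add_distrib, ite_add_ite, add_zero]
  map_smul' c p := by
    simp only [tubeFunctional_eq, nodeSum, edgeSum, Prod.smul_fst, Prod.smul_snd, Pi.smul_apply,
      smul_eq_mul, RingHom.id_apply, mul_add, Finset.mul_sum, mul_ite, mul_zero]

theorem tubeLin_apply (t : Graph α β) (p : Space G) : tubeLin G t p = tubeFunctional G t p := rfl

/-- The bundles: the pairs of distinct adjacent nodes. -/
abbrev Bundle (G : Graph α β) : Type _ := {b : Sym2 α // ¬ b.IsDiag ∧ ∃ e, ends G e = b}

instance : Finite (Bundle G) :=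
  Finite.of_surjective (fun e : {e : E(G) // ¬ (ends G e).IsDiag} ↦
    (⟨ends G e.1, e.2, e.1, rfl⟩ : Bundle G)) fun ⟨_, h, e, he⟩ ↦
      ⟨⟨e, he ▸ h⟩, Subtype.ext he⟩

instance : Fintype (Bundle G) := Fintype.ofFinite _

/-- The sum of the coordinates of the edges with given ends. -/
def bundleLin (G : Graph α β) [Fintype E(G)] (b : Sym2 α) : Space G →ₗ[ℝ] ℝ where
  toFun p := ∑ e : E(G), if ends G e = b then p.2 e else 0
  map_add' p q := by
    simp only [Prod.snd_add, Pi.add_apply, ← Finset.sum_add_distrib, ite_add_ite, add_zero]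
  map_smul' c p := by
    simp only [Prod.smul_snd, Pi.smul_apply, smul_eq_mul, RingHom.id_apply, Finset.mul_sum,
      mul_ite, mul_zero]

theorem bundleLin_apply (b : Sym2 α) (p : Space G) :
    bundleLin G b p = ∑ e : E(G), if ends G e = b then p.2 e else 0 := rfl

theorem bundleLin_mk (a b : α) (p : Space G) :
    bundleLin G s(a, b) p = edgeSum p {e | G.IsLink e a b} := by
  simp only [bundleLin_apply, edgeSum, mem_ofPred_eq, isLink_iff_ends]

theorem inSpan_iff : InSpan p ↔ tubeLin G G p = scale G ^ V(G).ncard ∧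
    ∀ b : Bundle G, bundleLin G b p = scale G := by
  rw [tubeLin_apply, tubeFunctional_self]
  refine ⟨fun h ↦ ⟨h.node, ?_⟩, fun h ↦ ⟨h.1, fun u v hne ⟨e, he⟩ ↦ ?_⟩⟩
  · rintro ⟨b, hb, e, he⟩
    induction b with
    | _ x y =>
      rw [bundleLin_mk]
      exact h.bundle x y hb ⟨e, (isLink_iff_ends e).2 he⟩
  · rw [← bundleLin_mk]
    exact h.2 ⟨s(u, v), hne, ⟨e, he.edge_mem⟩, (isLink_iff_ends ⟨e, he.edge_mem⟩).1 he⟩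

/-- The functionals of the tubes in `T`, of the whole graph and of the bundles. -/
def constraintMap (G : Graph α β) [Fintype V(G)] [Fintype E(G)] (T : Set (Graph α β)) :
    Space G →ₗ[ℝ] (↥(insert G T) ⊕ Bundle G → ℝ) :=
  LinearMap.pi (Sum.elim (fun t ↦ tubeLin G t) fun b ↦ bundleLin G b)

theorem mem_ker_constraintMap {w : Space G} : w ∈ LinearMap.ker (constraintMap G T) ↔
    tubeLin G G w = 0 ∧ (∀ t ∈ T, tubeLin G t w = 0) ∧ ∀ b : Bundle G, bundleLin G b w = 0 := by
  rw [LinearMap.mem_ker, constraintMap, funext_iff]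
  simp only [LinearMap.pi_apply, Pi.zero_apply, Sum.forall, Sum.elim_inl, Sum.elim_inr,
    Subtype.forall, mem_insert_iff, forall_eq_or_imp, and_assoc]

theorem tubeLin_single_node (t : Graph α β) (v : V(G)) :
    tubeLin G t (Pi.single v 1, 0) = if (v : α) ∈ V(t) then 1 else 0 := by
  rw [tubeLin_apply, tubeFunctional_eq, nodeSum, edgeSum]
  rw [Finset.sum_eq_single v (fun u _ hu ↦ by simp [hu]) (by simp)]
  simp

theorem tubeLin_single_edge (t : Graph α β) (e : E(G)) :
    tubeLin G t (0, Pi.single e 1) = if Excludes G t e then 1 else 0 := by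
  rw [tubeLin_apply, tubeFunctional_eq, nodeSum, edgeSum]
  rw [Finset.sum_eq_single (s := Finset.univ) e (fun u _ hu ↦ by simp [hu]) (by simp)]
  simp

theorem bundleLin_single_node (b : Sym2 α) (v : V(G)) :
    bundleLin G b (Pi.single v 1, 0) = 0 := by simp [bundleLin_apply]

theorem bundleLin_single_edge (b : Sym2 α) (e : E(G)) :
    bundleLin G b (0, Pi.single e 1) = if ends G e = b then 1 else 0 := by
  rw [bundleLin_apply, Finset.sum_eq_single e (fun u _ hu ↦ by simp [hu]) (by simp)]
  simp

/-- A linear relation among the functionals, evaluated at the unit vectors of nodes and edges, gives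
the hypotheses of `IsTubing.coeff_eq_zero`. -/
theorem IsTubing.constraintMap_surjective (hT : IsTubing G T) :
    Function.Surjective (constraintMap G T) := by
  have : Finite ↥(insert G T) := (hT.finite.insert G).to_subtype
  have : Fintype ↥(insert G T) := Fintype.ofFinite _
  refine LinearMap.pi_surjective_of_forall_sum_eq_zero _ fun g hg ↦ ?_
  simp only [Fintype.sum_sum_type, Sum.elim_inl, Sum.elim_inr] at hg
  set l : Graph α β → ℝ := fun t ↦ if h : t ∈ insert G T then g (.inl ⟨t, h⟩) else 0
  set m : Sym2 α → ℝ := fun b ↦ if h : ¬ b.IsDiag ∧ ∃ e, ends G e = b then g (.inr ⟨b, h⟩) else 0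
  have hlt : ∀ t : ↥(insert G T), g (.inl t) = l t := fun t ↦ by
    simp only [l]; rw [dif_pos t.2]
  have hmb : ∀ b : Bundle G, g (.inr b) = m b := fun b ↦ by
    simp only [m]; rw [dif_pos b.2]
  have hF : ∀ t, t ∈ (hT.finite.insert G).toFinset ↔ t ∈ insert G T := fun _ ↦
    (hT.finite.insert G).mem_toFinset
  have hsum : ∀ f : Graph α β → ℝ, ∑ t : ↥(insert G T), f t =
      ∑ t ∈ (hT.finite.insert G).toFinset, f t := fun f ↦
    (Finset.sum_subtype _ hF f).symm
  have hnode : ∀ v ∈ V(G), (∑ t ∈ (hT.finite.insert G).toFinset,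
      if v ∈ V(t) then l t else 0) = 0 := by
    intro v hv
    have h := hg (Pi.single ⟨v, hv⟩ 1, 0)
    simp only [tubeLin_single_node, bundleLin_single_node, mul_zero, Finset.sum_const_zero,
      add_zero, mul_ite, mul_one, hlt] at h
    rw [← hsum]
    exact h
  have hedge : ∀ e a b, G.IsLink e a b → (∑ t ∈ (hT.finite.insert G).toFinset,
      if Excludes G t e then l t else 0) + (if a = b then 0 else m s(a, b)) = 0 := by
    intro e a b hab
    have h := hg (0, Pi.single ⟨e, hab.edge_mem⟩ 1)
    simp only [tubeLin_single_edge, bundleLin_single_edge, mul_ite, mul_one, mul_zero, hlt, hmb]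
      at h
    rw [← hsum]
    refine Eq.trans ?_ h
    congr 1
    rw [(isLink_iff_ends ⟨e, hab.edge_mem⟩).1 hab]
    by_cases hne : a = b
    · rw [if_pos hne]
      refine (Finset.sum_eq_zero fun c _ ↦ if_neg fun h ↦ c.2.1 ?_).symm
      rw [← h]
      exact hne
    · rw [if_neg hne, Finset.sum_eq_single (⟨s(a, b), hne, ⟨e, hab.edge_mem⟩,
        (isLink_iff_ends ⟨e, hab.edge_mem⟩).1 hab⟩ : Bundle G)]
      · simp
      · intro c _ hc
        exact if_neg fun h ↦ hc (Subtype.ext h.symm)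
      · simp
  obtain ⟨h1, h2⟩ := hT.coeff_eq_zero hF hnode hedge
  funext i
  obtain t | ⟨b, hb, e, he⟩ := i
  · rw [hlt]
    exact h1 t ((hF t).2 t.2)
  · rw [hmb]
    induction b with
    | _ x y => exact h2 x y hb ⟨e, (isLink_iff_ends e).2 he⟩

theorem IsTubing.notMem (hT : IsTubing G T) : G ∉ T := fun h ↦ (hT.isTube G h).lt.false

theorem IsTubing.finrank_ker_constraintMap (hT : IsTubing G T) :
    Module.finrank ℝ (LinearMap.ker (constraintMap G T)) + T.ncard + 1 + Nat.card (Bundle G) =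
      V(G).ncard + E(G).ncard := by
  have : Finite ↥(insert G T) := (hT.finite.insert G).to_subtype
  have : Fintype ↥(insert G T) := Fintype.ofFinite _
  have h := LinearMap.finrank_range_add_finrank_ker (constraintMap G T)
  rw [LinearMap.range_eq_top.2 hT.constraintMap_surjective, finrank_top, Module.finrank_prod,
    Module.finrank_fintype_fun_eq_card, Module.finrank_fintype_fun_eq_card,
    Module.finrank_fintype_fun_eq_card, Fintype.card_sum, ← Nat.card_eq_fintype_card,
    ← Nat.card_eq_fintype_card, ← Nat.card_eq_fintype_card, ← Nat.card_eq_fintype_card,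
    Nat.card_coe_set_eq, Nat.card_coe_set_eq, Nat.card_coe_set_eq,
    ncard_insert_of_notMem hT.notMem hT.finite] at h
  omega

/-! ### Moving a point -/

theorem slack_add_smul (p w : Space G) (δ : ℝ) (t : Graph α β) :
    slack (p + δ • w) t = slack p t + δ * tubeLin G t w := by
  simp only [slack, ← tubeLin_apply, map_add, map_smul, smul_eq_mul]
  ring

theorem InSpan.add_smul (hp : InSpan p) {w : Space G}
    (hw : tubeLin G G w = 0 ∧ ∀ b : Bundle G, bundleLin G b w = 0) (δ : ℝ) :
    InSpan (p + δ • w) := by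
  rw [inSpan_iff] at hp ⊢
  simp [hw.1, hw.2, hp.1, hp.2]

theorem eventually_slack_pos (p w : Space G) :
    ∀ᶠ δ in 𝓝 (0 : ℝ), ∀ t, IsTube G t → 0 < slack p t → 0 < slack (p + δ • w) t := by
  refine (eventually_all_finite (finite_tubes G)).2 fun t _ ↦ ?_
  by_cases h : 0 < slack p t
  · have hc : Continuous fun δ : ℝ ↦ slack p t + δ * tubeLin G t w := by fun_prop
    have := hc.tendsto 0
    rw [zero_mul, add_zero] at this
    filter_upwards [this.eventually (lt_mem_nhds h)] with δ hδ _
    rwa [slack_add_smul]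
  · exact Eventually.of_forall fun δ h' ↦ absurd h' h

theorem mem_associahedron_iff_slack : p ∈ associahedron G ↔
    InSpan p ∧ ∀ t, IsTube G t → 0 ≤ slack p t := by
  simp only [mem_associahedron_iff, slack, sub_nonneg]

/-- For every tubing there is a point where exactly its inequalities are attained. -/
theorem IsTubing.exists_tightTubes_eq (hT : IsTubing G T) :
    ∃ p ∈ associahedron G, tightTubes p = T := by
  have hfin : {T : Set (Graph α β) | IsTubing G T}.Finite :=
    (finite_subgraphs G).finite_subsets.subset fun T hT t ht ↦ (hT.isTube t ht).lt.le
  obtain ⟨M, hTM, hM⟩ := hfin.exists_le_maximal hT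
  have hM : Maximal (IsTubing G) M := hM
  have hsurj := hM.prop.constraintMap_surjective
  obtain ⟨p, hp⟩ := hsurj (Sum.elim (fun t ↦ depth G t) fun _ ↦ scale G)
  -- A short move along `w` loosens exactly the inequalities of `M \ T`, while those outside `M`,
  -- strict at `p`, remain strict.
  obtain ⟨w, hw⟩ := hsurj (Sum.elim (fun t ↦ if (t : Graph α β) ∈ M \ T then 1 else 0) fun _ ↦ 0)
  have hp1 : ∀ t ∈ insert G M, tubeLin G t p = depth G t := fun t ht ↦
    congrFun hp (.inl ⟨t, ht⟩)
  have hp2 : ∀ b : Bundle G, bundleLin G b p = scale G := fun b ↦ congrFun hp (.inr b)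
  have hw1 : ∀ t ∈ insert G M, tubeLin G t w = if t ∈ M \ T then 1 else 0 := fun t ht ↦
    congrFun hw (.inl ⟨t, ht⟩)
  have hw2 : ∀ b : Bundle G, bundleLin G b w = 0 := fun b ↦ congrFun hw (.inr b)
  have hps : InSpan p := inSpan_iff.2 ⟨by rw [hp1 G (mem_insert _ _), depth_self], hp2⟩
  have hM0 : ∀ t ∈ M, slack p t = 0 := fun t ht ↦ sub_eq_zero.2 (hp1 t (.inr ht))
  have hwG : tubeLin G G w = 0 := by
    rw [hw1 G (mem_insert _ _), if_neg fun h ↦ hM.prop.notMem h.1]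
  obtain ⟨δ, hδ, hδ0⟩ := (((eventually_slack_pos p w).filter_mono nhdsWithin_le_nhds).and
    (self_mem_nhdsWithin (s := Ioi (0 : ℝ)))).exists
  have key : ∀ t, IsTube G t → (t ∈ T → slack (p + δ • w) t = 0) ∧
      (t ∉ T → 0 < slack (p + δ • w) t) := by
    intro t ht
    by_cases htM : t ∈ M
    · rw [slack_add_smul, hM0 t htM, hw1 t (.inr htM)]
      refine ⟨fun h ↦ by simp [h], fun h ↦ by simp [h, htM, hδ0]⟩
    · have hpos : 0 < slack p t := by
        by_contra! h
        exact htM (mem_of_slack_nonpos hM hps hM0 ht h)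
      exact ⟨fun h ↦ absurd (hTM h) htM, fun _ ↦ hδ t ht hpos⟩
  refine ⟨p + δ • w, mem_associahedron_iff_slack.2 ⟨hps.add_smul ⟨hwG, hw2⟩ δ, fun t ht ↦ ?_⟩, ?_⟩
  · by_cases h : t ∈ T
    · exact ((key t ht).1 h).ge
    · exact ((key t ht).2 h).le
  · ext t
    refine ⟨fun ⟨ht, h0⟩ ↦ ?_, fun h ↦ ⟨hT.isTube t h, (key t (hT.isTube t h)).1 h⟩⟩
    by_contra h
    exact ((key t ht).2 h).ne' h0

/-! ### Faces -/

/-- The points of the associahedron that attain the inequalities of the tubes in `T`. -/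
def tubingFace (G : Graph α β) [Fintype V(G)] [Fintype E(G)] (T : Set (Graph α β)) :
    Set (Space G) := {p | p ∈ associahedron G ∧ ∀ t ∈ T, slack p t = 0}

theorem tubingFace_empty : tubingFace G ∅ = associahedron G := by simp [tubingFace]

theorem mem_tubingFace_tightTubes (hp : p ∈ associahedron G) : p ∈ tubingFace G (tightTubes p) :=
  ⟨hp, fun _ ht ↦ ht.2⟩

theorem eventually_add_smul_mem (hp : p ∈ associahedron G) {w : Space G}
    (hw : w ∈ LinearMap.ker (constraintMap G (tightTubes p))) :
    ∀ᶠ δ in 𝓝 (0 : ℝ), p + δ • w ∈ tubingFace G (tightTubes p) := by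
  rw [mem_ker_constraintMap] at hw
  rw [mem_associahedron_iff_slack] at hp
  filter_upwards [eventually_slack_pos p w] with δ hδ
  have h0 : ∀ t ∈ tightTubes p, slack (p + δ • w) t = 0 := fun t ht ↦ by
    rw [slack_add_smul, ht.2, hw.2.1 t ht, mul_zero, add_zero]
  refine ⟨mem_associahedron_iff_slack.2 ⟨hp.1.add_smul ⟨hw.1, hw.2.2⟩ δ, fun t ht ↦ ?_⟩, h0⟩
  by_cases h : slack p t = 0
  · exact (h0 t ⟨ht, h⟩).ge
  · exact (hδ t ht (lt_of_le_of_ne (hp.2 t ht) (Ne.symm h))).le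

theorem sub_mem_ker_constraintMap (hp : p ∈ tubingFace G T) (hq : q ∈ tubingFace G T) :
    p - q ∈ LinearMap.ker (constraintMap G T) := by
  have hp1 := inSpan_iff.1 (mem_associahedron_iff.1 hp.1).1
  have hq1 := inSpan_iff.1 (mem_associahedron_iff.1 hq.1).1
  refine mem_ker_constraintMap.2 ⟨?_, fun t ht ↦ ?_, fun b ↦ ?_⟩
  · rw [map_sub, hp1.1, hq1.1, sub_self]
  · have h1 := hp.2 t ht
    have h2 := hq.2 t ht
    rw [slack, ← tubeLin_apply] at h1 h2
    rw [map_sub]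
    linarith
  · rw [map_sub, hp1.2, hq1.2, sub_self]

/-- The point `p` is relatively interior: it can be moved a little in every direction of the kernel,
as only its tight tubes constrain it. -/
theorem vectorSpan_tubingFace (hp : p ∈ associahedron G) :
    vectorSpan ℝ (tubingFace G (tightTubes p)) =
      LinearMap.ker (constraintMap G (tightTubes p)) := by
  refine le_antisymm ?_ fun w hw ↦ ?_
  · rw [vectorSpan_def, Submodule.span_le]
    rintro _ ⟨a, ha, b, hb, rfl⟩
    exact sub_mem_ker_constraintMap ha hb
  · obtain ⟨δ, hδ, hδ0⟩ := (((eventually_add_smul_mem hp hw).filter_mono nhdsWithin_le_nhds).and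
      (self_mem_nhdsWithin (s := Ioi (0 : ℝ)))).exists
    have h := vsub_mem_vectorSpan ℝ hδ (mem_tubingFace_tightTubes hp)
    rw [vsub_eq_sub, add_sub_cancel_left] at h
    have h' := Submodule.smul_mem _ δ⁻¹ h
    rwa [smul_smul, inv_mul_cancel₀ (ne_of_gt hδ0), one_smul] at h'

theorem IsTubing.dim_tubingFace (hT : IsTubing G T) :
    Polyhedral.dim (tubingFace G T) + T.ncard + 1 + Nat.card (Bundle G) =
      V(G).ncard + E(G).ncard := by
  obtain ⟨p, hp, rfl⟩ := hT.exists_tightTubes_eq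
  rw [Polyhedral.dim, vectorSpan_tubingFace hp, hT.finrank_ker_constraintMap]

/-- The sum of the functionals of `T` is at least the sum of the depths, with equality exactly when
each inequality is attained; its negative exposes the face. -/
theorem IsTubing.isFace_tubingFace (hT : IsTubing G T) :
    Polyhedral.IsFace (associahedron G) (tubingFace G T) := by
  obtain ⟨p, hp, hpT⟩ := hT.exists_tightTubes_eq
  have hpF : p ∈ tubingFace G T := hpT ▸ mem_tubingFace_tightTubes hp
  refine ⟨⟨p, hpF⟩, fun _ ↦
    ⟨LinearMap.toContinuousLinearMap (-∑ t ∈ hT.finite.toFinset, tubeLin G t), ?_⟩⟩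
  have hl : ∀ x, LinearMap.toContinuousLinearMap (-∑ t ∈ hT.finite.toFinset, tubeLin G t) x =
      -∑ t ∈ hT.finite.toFinset, tubeLin G t x := fun x ↦ by simp
  have hge : ∀ x ∈ associahedron G, ∀ t ∈ hT.finite.toFinset, depth G t ≤ tubeLin G t x :=
    fun x hx t ht ↦ (mem_associahedron_iff.1 hx).2 t (hT.isTube t (by simpa using ht))
  have heq : ∀ x ∈ tubingFace G T, ∀ t ∈ hT.finite.toFinset, depth G t = tubeLin G t x :=
    fun x hx t ht ↦ (sub_eq_zero.1 (hx.2 t (by simpa using ht))).symm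
  ext x
  constructor
  · intro hx
    refine ⟨hx.1, fun y hy ↦ ?_⟩
    rw [hl, hl, neg_le_neg_iff, ← Finset.sum_congr rfl (heq x hx)]
    exact Finset.sum_le_sum (hge y hy)
  · rintro ⟨hx, hmax⟩
    have h := hmax p hp
    rw [hl, hl, neg_le_neg_iff, ← Finset.sum_congr rfl (heq p hpF)] at h
    have h' := (Finset.sum_eq_sum_iff_of_le (hge x hx)).1
      (le_antisymm (Finset.sum_le_sum (hge x hx)) h)
    exact ⟨hx, fun t ht ↦ sub_eq_zero.2 (h' t (by simpa using ht)).symm⟩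

theorem exists_eq_tubingFace (hne : V(G).Nonempty) {F : Set (Space G)}
    (hF : Polyhedral.IsFace (associahedron G) F) : ∃ T, IsTubing G T ∧ F = tubingFace G T := by
  obtain ⟨hFne, hexp⟩ := hF
  obtain ⟨l, hl⟩ := hexp hFne
  have hFmem : ∀ x, x ∈ F ↔ x ∈ associahedron G ∧ ∀ y ∈ associahedron G, l y ≤ l x := fun x ↦ by
    rw [hl]; rfl
  -- A point with fewest tight tubes plays the role of a relative interior point of `F`.
  obtain ⟨p, hpF, hmin⟩ : ∃ p ∈ F, ∀ q ∈ F, (tightTubes p).ncard ≤ (tightTubes q).ncard := by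
    obtain ⟨p, hpF, hp⟩ := Nat.sInf_mem (hFne.image fun p ↦ (tightTubes p).ncard)
    exact ⟨p, hpF, fun q hq ↦ hp.trans_le (Nat.sInf_le (mem_image_of_mem _ hq))⟩
  obtain ⟨hp, hpmax⟩ := (hFmem p).1 hpF
  have hTp := isTubing_tightTubes hne hp
  refine ⟨tightTubes p, hTp, subset_antisymm (fun q hqF ↦ ?_) fun q hq ↦ ?_⟩
  · obtain ⟨hq, hqmax⟩ := (hFmem q).1 hqF
    -- The tubes tight at the midpoint are tight at both ends; by minimality they are all those of
    -- `p`, so `q` has them too.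
    set m : Space G := p + (1 / 2 : ℝ) • (q - p) with hm
    have hker : q - p ∈ LinearMap.ker (constraintMap G ∅) :=
      sub_mem_ker_constraintMap (by rwa [tubingFace_empty]) (by rwa [tubingFace_empty])
    rw [mem_ker_constraintMap] at hker
    have hms : ∀ t, slack m t = (slack p t + slack q t) / 2 := fun t ↦ by
      rw [hm, slack_add_smul, map_sub, tubeLin_apply, tubeLin_apply, slack, slack]; ring
    rw [mem_associahedron_iff_slack] at hp hq
    have hmP : m ∈ associahedron G := mem_associahedron_iff_slack.2
      ⟨hp.1.add_smul ⟨hker.1, hker.2.2⟩ _, fun t ht ↦ by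
        rw [hms]; linarith [hp.2 t ht, hq.2 t ht]⟩
    have hmF : m ∈ F := by
      refine (hFmem m).2 ⟨hmP, fun y hy ↦ ?_⟩
      have h1 := hpmax y hy
      have h2 := hqmax y hy
      rw [hm, map_add, map_smul, map_sub, smul_eq_mul]
      linarith
    have hsub : tightTubes m ⊆ tightTubes p ∩ tightTubes q := by
      rintro t ⟨ht, h0⟩
      rw [hms] at h0
      have h1 := hp.2 t ht
      have h2 := hq.2 t ht
      exact ⟨⟨ht, by linarith⟩, ht, by linarith⟩
    have heq : tightTubes m = tightTubes p :=
      eq_of_subset_of_ncard_le (hsub.trans inter_subset_left) (hmin m hmF) hTp.finite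
    exact ⟨mem_associahedron_iff_slack.2 hq, fun t ht ↦ (hsub (heq ▸ ht)).2.2⟩
  -- The segment from `q` extends a little beyond `p` inside the associahedron. As `l` is maximal at
  -- `p`, it cannot be smaller at `q`.
  · have hw := sub_mem_ker_constraintMap (mem_tubingFace_tightTubes hp) hq
    obtain ⟨δ, hδ, hδ0⟩ := (((eventually_add_smul_mem hp hw).filter_mono nhdsWithin_le_nhds).and
      (self_mem_nhdsWithin (s := Ioi (0 : ℝ)))).exists
    have h := hpmax _ hδ.1
    rw [map_add, map_smul, map_sub, smul_eq_mul] at h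
    have hle : l p ≤ l q := by
      by_contra! hlt
      nlinarith [mul_pos hδ0 (sub_pos.2 hlt)]
    exact (hFmem q).2 ⟨hq.1, fun y hy ↦ (hpmax y hy).trans hle⟩

theorem IsTubing.tubingFace_subset_iff (hT : IsTubing G T) (hS : IsTubing G S) :
    tubingFace G T ⊆ tubingFace G S ↔ S ⊆ T := by
  refine ⟨fun h t ht ↦ ?_, fun h p hp ↦ ⟨hp.1, fun t ht ↦ hp.2 t (h ht)⟩⟩
  obtain ⟨p, hp, rfl⟩ := hT.exists_tightTubes_eq
  exact ⟨hS.isTube t ht, (h (mem_tubingFace_tightTubes hp)).2 t ht⟩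

/-- Tubings under reverse inclusion are the nonempty faces of the associahedron. -/
def facePosetIso (hne : V(G).Nonempty) :
    (Tubing G)ᵒᵈ ≃o Polyhedral.FacePoset (associahedron G) :=
  RelIso.ofSurjective (OrderEmbedding.ofMapLEIff
    (fun T ↦ ⟨tubingFace G (OrderDual.ofDual T).1, (OrderDual.ofDual T).2.isFace_tubingFace⟩)
    fun T S ↦ (OrderDual.ofDual T).2.tubingFace_subset_iff (OrderDual.ofDual S).2)
    fun F ↦ by
      obtain ⟨T, hT, h⟩ := exists_eq_tubingFace hne F.2
      exact ⟨OrderDual.toDual ⟨T, hT⟩, Subtype.ext h.symm⟩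

theorem isTubing_empty (hne : V(G).Nonempty) : IsTubing G ∅ := by
  refine ⟨by simp, by simp, fun h ↦ ?_⟩
  suffices ∃ C, IsComponent G C from this.elim fun C hC ↦ h C hC
  exact closed_induction (P := fun _ ↦ ∃ C, IsComponent G C) (toFinite V(G)) hne
    (fun C hC hcon ↦ ⟨C, isComponent_of_isClosedSubgraph hC hcon⟩)
    fun _ _ _ _ _ _ _ _ _ _ h _ ↦ h

theorem IsTubing.dim_tubingFace_add_ncard (hne : V(G).Nonempty) (hT : IsTubing G T) :
    Polyhedral.dim (tubingFace G T) + T.ncard = Polyhedral.dim (associahedron G) := by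
  have h1 := hT.dim_tubingFace
  have h2 := (isTubing_empty hne).dim_tubingFace
  rw [tubingFace_empty, ncard_empty] at h2
  omega

/-- A vertex is the face of a tubing with `dim` many tubes, and the facets through it are the faces
of its one-element subsets. -/
theorem isSimple_associahedron (hne : V(G).Nonempty) :
    Polyhedral.IsSimple (associahedron G) := by
  intro v hv
  obtain ⟨T, hT, hvT⟩ := exists_eq_tubingFace hne hv
  have hd := hT.dim_tubingFace_add_ncard hne
  have h0 : Polyhedral.dim (tubingFace G T) = 0 := by
    rw [← hvT, Polyhedral.dim, vectorSpan_singleton, finrank_bot]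
  rw [h0, zero_add] at hd
  have hsing : ∀ t ∈ T, IsTubing G {t} := fun t ht ↦ hT.subset (singleton_subset_iff.2 ht)
  have hset : {F : Set (Space G) | Polyhedral.IsFace (associahedron G) F ∧
      Polyhedral.dim F + 1 = Polyhedral.dim (associahedron G) ∧ v ∈ F} =
      (fun t ↦ tubingFace G {t}) '' T := by
    ext F
    constructor
    · rintro ⟨hF, hdim, hvF⟩
      obtain ⟨S, hS, rfl⟩ := exists_eq_tubingFace hne hF
      have hSd := hS.dim_tubingFace_add_ncard hne
      obtain ⟨t, rfl⟩ := ncard_eq_one.1 (by omega : S.ncard = 1)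
      refine ⟨t, singleton_subset_iff.1 ((hT.tubingFace_subset_iff hS).1 ?_), rfl⟩
      rw [← hvT]
      exact singleton_subset_iff.2 hvF
    · rintro ⟨t, ht, rfl⟩
      have h1 := (hsing t ht).dim_tubingFace_add_ncard hne
      rw [ncard_singleton] at h1
      refine ⟨(hsing t ht).isFace_tubingFace, h1, ?_⟩
      have := (hT.tubingFace_subset_iff (hsing t ht)).2 (singleton_subset_iff.2 ht)
      rw [← hvT] at this
      exact singleton_subset_iff.1 this
  rw [hset, InjOn.encard_image, ← hd, hT.finite.cast_ncard_eq]
  intro s hs t ht hst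
  have := ((hsing s hs).tubingFace_subset_iff (hsing t ht)).1 hst.subset
  exact (singleton_subset_singleton.1 this).symm

end Pseudograph

/-! ### Redundant edges, boundedness and lines. -/

namespace Pseudograph

open Set Filter Topology
open scoped Classical

set_option linter.unusedSectionVars false

variable {α β : Type*} {G t : Graph α β} [Fintype V(G)] [Fintype E(G)] {p : Space G}

/-! ### The number of redundant edges -/

/-- After the removal no loops are left and at most one edge per bundle. -/
theorem ncard_edgeSet_le (F : Set β) (hF : F ⊆ E(G)) (hs : (G.deleteEdges F).Simple) :
    E(G).ncard ≤ F.ncard + Nat.card (Bundle G) := by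
  have hmem : ∀ e : ↥(E(G) \ F), ¬ (ends G ⟨e, e.2.1⟩).IsDiag ∧ ∃ e', ends G e' =
      ends G ⟨e, e.2.1⟩ := by
    refine fun e ↦ ⟨fun hd ↦ ?_, _, rfl⟩
    obtain ⟨a, b, hab⟩ := Graph.exists_isLink_of_mem_edgeSet e.2.1
    rw [(isLink_iff_ends (G := G) ⟨(e : β), e.2.1⟩).1 hab, Sym2.mk_isDiag_iff] at hd
    subst hd
    exact hs.not_isLoopAt e a (Graph.deleteEdges_isLoopAt.2 ⟨hab, e.2.2⟩)
  have hinj : Function.Injective (fun e : ↥(E(G) \ F) ↦ (⟨_, hmem e⟩ : Bundle G)) := by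
    intro e e' h
    have h : ends G ⟨e, e.2.1⟩ = ends G ⟨e', e'.2.1⟩ := congrArg Subtype.val h
    obtain ⟨a, b, hab⟩ := Graph.exists_isLink_of_mem_edgeSet e.2.1
    have hab' : G.IsLink e' a b :=
      (isLink_iff_ends (G := G) ⟨(e' : β), e'.2.1⟩).2 (h ▸ (isLink_iff_ends (G := G) ⟨(e : β), e.2.1⟩).1 hab)
    exact Subtype.ext (hs.eq_of_isLink (x := a) (y := b)
      (by simpa using ⟨hab, e.2.2⟩)
      (by simpa using ⟨hab', e'.2.2⟩))
  have h : Nat.card ↥(E(G) \ F) ≤ Nat.card (Bundle G) := Nat.card_le_card_of_injective _ hinj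
  rw [Nat.card_coe_set_eq] at h
  have := ncard_sdiff_add_ncard_of_subset hF (toFinite E(G))
  omega

/-- Keep one chosen edge of each bundle and delete everything else. -/
theorem exists_simple_deleteEdges (G : Graph α β) [Fintype V(G)] [Fintype E(G)] :
    ∃ F ⊆ E(G), F.ncard + Nat.card (Bundle G) = E(G).ncard ∧ (G.deleteEdges F).Simple := by
  choose σ hσ using fun b : Bundle G ↦ b.2.2
  have hinj : Function.Injective fun b ↦ (σ b : β) := fun b b' h ↦ by
    have h : σ b = σ b' := Subtype.ext h
    exact Subtype.ext ((hσ b).symm.trans (h ▸ hσ b'))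
  have hsub : range (fun b ↦ (σ b : β)) ⊆ E(G) := by
    rintro _ ⟨b, rfl⟩
    exact (σ b).2
  have hedge : ∀ {e x y}, (G.deleteEdges (E(G) \ range fun b ↦ (σ b : β))).IsLink e x y →
      ∃ b : Bundle G, (σ b : β) = e ∧ (b : Sym2 α) = s(x, y) := by
    intro e x y h
    rw [Graph.deleteEdges_isLink] at h
    have : e ∈ range fun b ↦ (σ b : β) := by
      by_contra hn
      exact h.2 ⟨h.1.edge_mem, hn⟩
    obtain ⟨b, rfl⟩ := this
    exact ⟨b, rfl, (hσ b).symm.trans ((isLink_iff_ends (σ b)).1 h.1)⟩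
  refine ⟨E(G) \ range fun b ↦ (σ b : β), sdiff_subset, ?_, ?_⟩
  · have h1 := ncard_sdiff_add_ncard_of_subset hsub (toFinite E(G))
    rw [← image_univ, ncard_image_of_injective _ hinj, ncard_univ] at h1
    rw [← image_univ]
    exact h1
  · refine { not_isLoopAt := fun e x h ↦ ?_, eq_of_isLink := fun e f x y he hf ↦ ?_ }
    · obtain ⟨b, -, hb⟩ := hedge h
      exact b.2.1 (by rw [hb]; rfl)
    · obtain ⟨b, rfl, hb⟩ := hedge he
      obtain ⟨b', rfl, hb'⟩ := hedge hf
      rw [Subtype.ext (hb.trans hb'.symm)]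

theorem redundantEdges_add_card_bundle :
    redundantEdges G + Nat.card (Bundle G) = E(G).ncard := by
  obtain ⟨F, hF, hcard, hs⟩ := exists_simple_deleteEdges G
  refine le_antisymm ?_ ?_
  · have : redundantEdges G ≤ F.ncard := Nat.sInf_le ⟨F, hF, rfl, hs⟩
    omega
  · obtain ⟨F', hF', hcard', hs'⟩ := Nat.sInf_mem (s := {k | ∃ F ⊆ E(G), F.ncard = k ∧
      (G.deleteEdges F).Simple}) ⟨_, F, hF, rfl, hs⟩
    rw [redundantEdges, ← hcard']
    exact ncard_edgeSet_le F' hF' hs'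

theorem dim_associahedron (hne : V(G).Nonempty) :
    (Polyhedral.dim (associahedron G) : ℤ) = (V(G).ncard : ℤ) - 1 + redundantEdges G := by
  have h1 := (isTubing_empty hne).dim_tubingFace
  rw [tubingFace_empty, ncard_empty] at h1
  have h2 := redundantEdges_add_card_bundle (G := G)
  omega

/-! ### The associahedron is a polyhedron -/

theorem isPolyhedron_associahedron : Polyhedral.IsPolyhedron (associahedron G) := by
  refine ⟨{(tubeLin G G, scale G ^ V(G).ncard), (-tubeLin G G, -scale G ^ V(G).ncard)} ∪
    (range (fun b : Bundle G ↦ (bundleLin G b, scale G)) ∪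
    range (fun b : Bundle G ↦ (-bundleLin G b, -scale G))) ∪
    (fun t ↦ (-tubeLin G t, -depth G t)) '' {t | IsTube G t}, ?_, ?_⟩
  · exact ((toFinite _).union ((finite_range _).union (finite_range _))).union
      ((finite_tubes G).image _)
  · ext p
    rw [mem_associahedron_iff, inSpan_iff]
    constructor
    · rintro ⟨⟨h1, h2⟩, h3⟩ h (((rfl | rfl) | (⟨b, rfl⟩ | ⟨b, rfl⟩)) | ⟨t, ht, rfl⟩)
      · exact h1.le
      · exact (neg_le_neg h1.ge :)
      · exact (h2 b).le
      · exact (neg_le_neg (h2 b).ge :)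
      · exact (neg_le_neg (h3 t ht) :)
    · intro h
      refine ⟨⟨le_antisymm (h _ (.inl (.inl (.inl rfl)))) ?_, fun b ↦ le_antisymm
        (h _ (.inl (.inr (.inl ⟨b, rfl⟩)))) ?_⟩, fun t ht ↦ ?_⟩
      · exact neg_le_neg_iff.1 (h _ (.inl (.inl (.inr rfl))) :)
      · exact neg_le_neg_iff.1 (h _ (.inl (.inr (.inr ⟨b, rfl⟩))) :)
      · exact neg_le_neg_iff.1 (h _ (.inr ⟨t, ht, rfl⟩) :)

/-! ### Bounds for the coordinates -/

theorem tubeFunctional_nonneg (hp : p ∈ associahedron G) (ht : IsWeakTube G t) :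
    0 ≤ tubeFunctional G t p := by
  have h1 := slack_nonneg_of_mem hp ht
  have h2 := le_depth (G := G) t
  have h3 : 0 ≤ scale G ^ V(t).ncard := by rw [scale]; positivity
  rw [slack] at h1
  linarith

theorem nodeSum_singleton (p : Space G) (v : V(G)) : nodeSum p {(v : α)} = p.1 v := by
  rw [nodeSum, Finset.sum_eq_single v]
  · simp
  · exact fun u _ hu ↦ if_neg fun h ↦ hu (Subtype.ext h)
  · simp

theorem node_nonneg (hp : p ∈ associahedron G) (v : V(G)) : 0 ≤ p.1 v := by
  -- With all loops at `v` included, this one-node graph excludes no edge, so its functional is the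
  -- coordinate of `v`.
  set t := subgraph G {(v : α)} univ with ht
  have hw : IsWeakTube G t := by
    refine ⟨subgraph_le (singleton_subset_iff.2 v.2), ⟨⟨v, rfl⟩, ?_⟩, ?_⟩
    · rintro u rfl w rfl
      exact .refl
    · rintro u rfl w rfl hne
      exact absurd rfl hne
  have h := tubeFunctional_nonneg hp hw
  have hex : {e | Excludes G t e} = ∅ := by
    refine eq_empty_of_forall_notMem fun e he ↦ ?_
    obtain ⟨a, b, hab⟩ := Graph.exists_isLink_of_mem_edgeSet he.1
    rw [mem_ofPred_eq, excludes_iff hab] at he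
    exact he.1 ((mem_edgeSet_subgraph hab).2 ⟨mem_univ _, he.2⟩)
  rwa [tubeFunctional_eq, hex, edgeSum_empty, add_zero, ht, vertexSet_subgraph,
    nodeSum_singleton] at h

theorem nodeSum_le (hp : p ∈ associahedron G) (A : Set α) :
    nodeSum p A ≤ scale G ^ V(G).ncard := by
  rw [← (mem_associahedron_iff.1 hp).1.node]
  refine Finset.sum_le_sum fun v _ ↦ ?_
  rw [if_pos v.2]
  split_ifs
  · exact le_rfl
  · exact node_nonneg hp v

theorem node_le (hp : p ∈ associahedron G) (v : V(G)) : p.1 v ≤ scale G ^ V(G).ncard := by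
  have h := nodeSum_le hp {(v : α)}
  rwa [nodeSum_singleton] at h

theorem le_edge (hp : p ∈ associahedron G) (e : E(G)) : -scale G ^ V(G).ncard ≤ p.2 e := by
  obtain ⟨a, b, hab⟩ := Graph.exists_isLink_of_mem_edgeSet e.2
  have hc : 0 ≤ scale G := by rw [scale]; positivity
  by_cases hex : a = b ∨ ∃ e', G.IsLink e' a b ∧ e' ≠ e
  -- This graph excludes only `e`, so $x(V(t))+y_e\ge0$, and node sums are at most $c^n$. In the
  -- remaining case `e` is its whole bundle and $y_e=c$.
  · set t := subgraph G {a, b} {(e : β)}ᶜ with ht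
    have hadj : a ≠ b → t.Adj a b := by
      intro hne
      obtain ⟨e', he', hee'⟩ := hex.resolve_left hne
      exact ⟨e', ⟨hee', he'⟩, .inl rfl, .inr rfl⟩
    have hw : IsWeakTube G t := by
      refine ⟨subgraph_le ?_, ⟨⟨a, .inl rfl⟩, ?_⟩, ?_⟩
      · rintro x (rfl | rfl)
        · exact hab.left_mem
        · exact hab.right_mem
      · rintro u (rfl | rfl) w (rfl | rfl)
        · exact .refl
        · by_cases h : u = w
          · exact h ▸ .refl
          · exact .single (hadj h)
        · by_cases h : w = u
          · exact h ▸ .refl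
          · exact .single (hadj h).symm
        · exact .refl
      · rintro u (rfl | rfl) w (rfl | rfl) hne -
        · exact absurd rfl hne
        · exact hadj hne
        · exact (hadj hne.symm).symm
        · exact absurd rfl hne
    have h := tubeFunctional_nonneg hp hw
    have hset : {e' | Excludes G t e'} = {(e : β)} := by
      ext e'
      constructor
      · intro he'
        obtain ⟨x, y, hxy⟩ := Graph.exists_isLink_of_mem_edgeSet he'.1
        rw [mem_ofPred_eq, excludes_iff hxy] at he'
        by_contra hne
        exact he'.1 ((mem_edgeSet_subgraph hxy).2 ⟨hne, he'.2⟩)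
      · rintro rfl
        exact (excludes_iff hab).2 ⟨fun h ↦ ((mem_edgeSet_subgraph hab).1 h).1 rfl, .inl rfl,
          .inr rfl⟩
    have hle := nodeSum_le hp V(t)
    rw [tubeFunctional_eq, hset, edgeSum_eq_sum p (F := {e}) (by simp [Subtype.ext_iff]),
      Finset.sum_singleton] at h
    linarith
  · push Not at hex
    have h := (mem_associahedron_iff.1 hp).1.bundle a b hex.1 hab.adj
    rw [edgeSum_eq_sum p (F := {e}) ?_, Finset.sum_singleton] at h
    · have : 0 ≤ scale G ^ V(G).ncard := by positivity
      linarith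
    · intro e'
      rw [Finset.mem_singleton]
      exact ⟨fun h ↦ h ▸ hab, fun h ↦ Subtype.ext (hex.2 e' h)⟩

theorem edge_le (hG : G.Loopless) (hp : p ∈ associahedron G) (e : E(G)) :
    p.2 e ≤ scale G + Fintype.card E(G) * scale G ^ V(G).ncard := by
  obtain ⟨a, b, hab⟩ := Graph.exists_isLink_of_mem_edgeSet e.2
  have hc : 0 ≤ scale G ^ V(G).ncard := by rw [scale]; positivity
  have h := (mem_associahedron_iff.1 hp).1.bundle a b hab.ne hab.adj
  rw [edgeSum_eq_sum p (F := {e' : E(G) | G.IsLink e' a b}) (by simp)] at h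
  have h1 := Finset.single_le_sum (f := fun e' ↦ p.2 e' + scale G ^ V(G).ncard)
    (s := {e' : E(G) | G.IsLink e' a b}) (fun e' _ ↦ by linarith [le_edge hp e'])
    (Finset.mem_filter.2 ⟨Finset.mem_univ e, hab⟩)
  rw [Finset.sum_add_distrib, h, Finset.sum_const, nsmul_eq_mul] at h1
  have h2 : ((Finset.card {e' : E(G) | G.IsLink e' a b} : ℕ) : ℝ) ≤ Fintype.card E(G) := by
    exact_mod_cast Finset.card_le_univ _
  have h3 := mul_le_mul_of_nonneg_right h2 hc
  linarith

theorem isBounded_associahedron (hG : G.Loopless) : Bornology.IsBounded (associahedron G) := by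
  refine (Metric.isBounded_Icc
    ((fun _ ↦ 0, fun _ ↦ -scale G ^ V(G).ncard) : Space G)
    (fun _ ↦ scale G ^ V(G).ncard,
      fun _ ↦ scale G + Fintype.card E(G) * scale G ^ V(G).ncard)).subset fun p hp ↦ ?_
  exact ⟨⟨node_nonneg hp, le_edge hp⟩, node_le hp, edge_le hG hp⟩

theorem eq_zero_of_forall_le {a b K : ℝ} (h : ∀ t : ℝ, K ≤ a + t * b) : b = 0 := by
  by_contra hb
  have := h ((K - a - 1) / b)
  rw [div_mul_cancel₀ _ hb] at this
  linarith

/-- Every coordinate is bounded below on the associahedron, and an affine function bounded below on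
a whole line is constant. -/
theorem line_associahedron (p v : Space G) (h : ∀ t : ℝ, p + t • v ∈ associahedron G) : v = 0 := by
  refine Prod.ext (funext fun u ↦ ?_) (funext fun e ↦ ?_)
  · exact eq_zero_of_forall_le (fun t ↦ node_nonneg (h t) u)
  · exact eq_zero_of_forall_le (fun t ↦ le_edge (h t) e)

theorem not_isBounded_associahedron (hne : V(G).Nonempty) (hG : ¬ G.Loopless) :
    ¬ Bornology.IsBounded (associahedron G) := by
  rw [Graph.loopless_iff] at hG
  push Not at hG
  obtain ⟨e, x, he⟩ := hG
  obtain ⟨p, hp, -⟩ := (isTubing_empty hne).exists_tightTubes_eq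
  have heG : e ∈ E(G) := he.edge_mem
  -- The coordinate of a loop lies in no bundle equation and has coefficient $0$ or $1$ in every
  -- inequality, so increasing it gives a ray.
  set w : Space G := (0, Pi.single ⟨e, heG⟩ 1) with hw
  have hmem : ∀ δ : ℝ, 0 ≤ δ → p + δ • w ∈ associahedron G := by
    intro δ hδ
    rw [mem_associahedron_iff_slack] at hp ⊢
    refine ⟨hp.1.add_smul ⟨?_, fun b ↦ ?_⟩ δ, fun t ht ↦ ?_⟩
    · rw [hw, tubeLin_single_edge, if_neg fun h ↦ h.2.1 heG]
    · rw [hw, bundleLin_single_edge, if_neg fun h ↦ b.2.1 ?_]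
      rw [← h, (isLink_iff_ends ⟨e, heG⟩).1 he]
      rfl
    · rw [slack_add_smul, hw, tubeLin_single_edge]
      have := hp.2 t ht
      split_ifs <;> linarith
  intro hb
  obtain ⟨C, hC⟩ := hb.exists_norm_le
  have h1 := hC _ (hmem (|C| + 1 + |p.2 ⟨e, heG⟩|) (by positivity))
  have h2 := (norm_le_pi_norm _ (⟨e, heG⟩ : E(G))).trans ((norm_snd_le _).trans h1)
  simp only [hw, Prod.snd_add, Prod.smul_snd, Pi.add_apply, Pi.smul_apply, Pi.single_eq_same,
    smul_eq_mul, mul_one, Real.norm_eq_abs] at h2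
  have h3 := (le_abs_self _).trans h2
  linarith [le_abs_self C, neg_abs_le (p.2 ⟨e, heG⟩)]

end Pseudograph

end

/-- For a finite pseudograph `G` with at least one node, the pseudograph associahedron has
dimension `n - 1 + r`; it is a simple convex polytope if `G` has no loops and a simple polytopal
cone otherwise; its face poset is the set of tubings under reverse inclusion, tubings with `k`
tubes corresponding to faces of codimension `k`. -/
theorem theorem1 {α β : Type*} (G : Graph α β) (hV : V(G).Finite) (hE : E(G).Finite)
    (hne : V(G).Nonempty) :
    ((Polyhedral.dim (Pseudograph.associahedron G) : ℤ)
        = (V(G).ncard : ℤ) - 1 + (Pseudograph.redundantEdges G : ℤ)) ∧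
    (G.Loopless →
      Polyhedral.IsConvexPolytope (Pseudograph.associahedron G) ∧
      Polyhedral.IsSimple (Pseudograph.associahedron G)) ∧
    (¬ G.Loopless →
      Polyhedral.IsPolytopalCone (Pseudograph.associahedron G) ∧
      Polyhedral.IsSimple (Pseudograph.associahedron G)) ∧
    ∃ Φ : (Pseudograph.Tubing G)ᵒᵈ ≃o Polyhedral.FacePoset (Pseudograph.associahedron G),
      ∀ T : Pseudograph.Tubing G,
        Polyhedral.dim (Φ (OrderDual.toDual T)).1 + T.1.ncard
          = Polyhedral.dim (Pseudograph.associahedron G) := by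
  have := hV.fintype
  have := hE.fintype
  exact ⟨Pseudograph.dim_associahedron hne,
    fun h ↦ ⟨⟨Pseudograph.isPolyhedron_associahedron, Pseudograph.isBounded_associahedron h⟩,
      Pseudograph.isSimple_associahedron hne⟩,
    fun h ↦ ⟨⟨Pseudograph.isPolyhedron_associahedron,
      Pseudograph.not_isBounded_associahedron hne h, Pseudograph.line_associahedron⟩,
      Pseudograph.isSimple_associahedron hne⟩,
    Pseudograph.facePosetIso hne, fun T ↦ T.2.dim_tubingFace_add_ncard hne⟩
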